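/- **Setting.** Let $(\Gamma,d)$ be a countable metric space that is $\nu$-regular: there are $\kappa,\nu>0$ such that every closed ball of radius $n+1$ ($n=0,1,2,\dots$) has at most $\kappa(n+1)^\nu$ points. Attach to every $x\in\Gamma$ a finite-dimensional complex Hilbert space $\mathcal H_x$, and put $\mathcal A_Z=\mathcal B(\bigotimes_{x\in Z}\mathcal H_x)$ for finite $Z\subset\Gamma$, with the operator norm; for $Z\subset\Lambda$ regard $\mathcal A_Z\subset\mathcal A_\Lambda$ through $A\mapsto A\otimes 1$. A dissipative interaction $\mathscr L=\{L_Z\}$ assigns to each finite $Z\subset\Gamma$ a linear map $L_Z$ on $\mathcal A_Z$ of the form $L_Z(A)=i[H,A]+\sum_{j=1}^{\ell}\big(K_j^*AK_j-\tfrac12\{K_j^*K_j,A\}\big)$ with $H=H^*$, $K_j\in\mathcal A_Z$ depending on $Z$. For finite $\Lambda\subset\Gamma$ put $T^\Lambda_t=\exp\big(t\sum_{Z\subset\Lambda}L_Z\big)$ on $\mathcal A_\Lambda$, where $L_Z$ acts as $L_Z\otimes\mathrm{id}_{\Lambda\setminus Z}$. For $F:[0,\infty)\to(0,\infty)$ let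 $\|F\|=\sup_x\sum_yF(d(x,y))$, let $C_F$ be the infimum of all $C$ with $\sum_zF(d(x,z))F(d(z,y))\le C\,F(d(x,y))$ for all $x,y\in\Gamma$, and let $\|\mathscr L\|_F$ be the infimum of all $M$ with $\sum_{Z\ni x,y}\|L_Z\|_{cb}\le M\,F(d(x,y))$ for all $x,y\in\Gamma$, where $\|\cdot\|_{cb}$ is the completely bounded norm. A state $\pi$ on $\mathcal A_\Lambda$ is a local dynamical fixed point of $\mathscr L$ with convergence governed by $g_\Lambda:[0,\infty)\to[0,2]$ if $\pi\circ T^\Lambda_t=\pi$ for all $t\ge0$, and $|(\pi-\omega)(T^\Lambda_t(A))|\le g_\Lambda(t)\|A\|$ for all states $\omega$ on $\mathcal A_\Lambda$, all $A\in\mathcal A_\Lambda$ and all $t\ge0$. **Lemma 3.6.** Let $F(r)=(1+r)^{-\alpha}$ with $\alpha>2\nu+1$, and let $\mathscr L$ be a dissipative interaction with $0<\|\mathscr L\|_F<\infty$. Fix $\epsilon\in(0,\alpha-2\nu-1)$, set $\alpha_\epsilon=\alpha-\nu-1-\epsilon$, and let $0<\delta<1$ satisfy $(1-\delta)\alpha_\epsilon>\nu$.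 Let $\Lambda\subset\Gamma$ be finite and let $\pi$ be a local dynamical fixed point of $\mathscr L$ on $\mathcal A_\Lambda$ with convergence governed by $g_\Lambda$. Let $X,Y\subset\Lambda$ be nonempty with $d(X,Y)=\min_{x\in X,\,y\in Y}d(x,y)>2$, and let $A\in\mathcal A_X$, $B\in\mathcal A_Y$. Then for every $0<\eta<\min\{\delta,(1-\delta)\alpha_\epsilon-\nu\}$, $$|\pi(AB)-\pi(A)\pi(B)|\le \frac{C'\,\|A\|\,\|B\|\,(|X|+|Y|)\,\|\mathscr L\|_F}{(1+d(X,Y))^{(1-\delta)\alpha_\epsilon-\nu-\eta}}+3\|A\|\,\|B\|\,g_\Lambda\!\left(\frac{d(X,Y)^\eta}{e\,v\,2^\eta}\right),$$ where $v=\|\mathscr L\|_F\,C_F$, $C'=\dfrac{3C}{ev}\,2^{(1-\delta)\alpha_\epsilon-\nu-\eta}$, $$C=\frac{\kappa C_\epsilon}{C_F}\Big(\kappa\,2^{2\alpha_\epsilon}2^{1-\delta}(C_\epsilon+C_F)+e\,(C_F+\|F\|)\Big),\qquad C_\epsilon=\sum_{n\ge0}\frac1{(1+n)^{1+\epsilon}}.$$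 -/

import Mathlib

open scoped Matrix.Norms.L2Operator ENNReal

noncomputable section

namespace OpenSpin

/-! ### Geometry and decay functions -/

/-- `Γ` is `ν`-regular with constant `κ`: every closed ball of integer radius `n + 1` is finite, with
at most `κ (n + 1) ^ ν` points. -/
structure IsRegularSpace (Γ : Type*) [MetricSpace Γ] (κ ν : ℝ) : Prop where
  kappa_pos : 0 < κ
  nu_pos : 0 < ν
  ball_finite : ∀ (x : Γ) (n : ℕ), (Metric.closedBall x ((n : ℝ) + 1)).Finite
  ball_card : ∀ (x : Γ) (n : ℕ),
    ((Metric.closedBall x ((n : ℝ) + 1)).ncard : ℝ) ≤ κ * ((n : ℝ) + 1) ^ ν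

/-- The distance `d(X, Y) = inf {d(x, y) : x ∈ X, y ∈ Y}` between finite sets. (It is `0` by
convention if one of them is empty, so `2 < setDist X Y` forces both to be nonempty.) -/
def setDist {Γ : Type*} [MetricSpace Γ] (X Y : Finset Γ) : ℝ :=
  sInf {r : ℝ | ∃ x ∈ X, ∃ y ∈ Y, r = dist x y}

/-- The power law `F(r) = 1 / (1 + r) ^ α`. -/
def powerLaw (α : ℝ) (r : ℝ) : ℝ := 1 / (1 + r) ^ α

/-- `‖F‖ = sup_x ∑_y F(d(x, y))`, as an extended nonnegative number. -/
def decaySum (Γ : Type*) [MetricSpace Γ] (F : ℝ → ℝ) : ℝ≥0∞ :=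
  ⨆ x : Γ, ∑' y : Γ, ENNReal.ofReal (F (dist x y))

/-- The convolution constant `C_F`: the infimum of all `C` such that
`∑_z F(d(x, z)) F(d(z, y)) ≤ C F(d(x, y))` for all `x, y`. -/
def convConst (Γ : Type*) [MetricSpace Γ] (F : ℝ → ℝ) : ℝ≥0∞ :=
  sInf {C : ℝ≥0∞ | ∀ x y : Γ,
    ∑' z : Γ, ENNReal.ofReal (F (dist x z)) * ENNReal.ofReal (F (dist z y)) ≤
      C * ENNReal.ofReal (F (dist x y))}

/-! ### Linear maps on matrix algebras -/

section MatrixMaps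

variable {S : Type*} [Fintype S] [DecidableEq S]

/-- `Φ ⊗ id_n`: the map `Φ` applied to each of the `n × n` blocks of a matrix. -/
def blockMap (n : ℕ) (Φ : Matrix S S ℂ →ₗ[ℂ] Matrix S S ℂ)
    (M : Matrix (S × Fin n) (S × Fin n) ℂ) : Matrix (S × Fin n) (S × Fin n) ℂ :=
  Matrix.of fun p r => Φ (Matrix.of fun a b => M (a, p.2) (b, r.2)) p.1 r.1

/-- The completely bounded norm `sup_n ‖Φ ⊗ id_n‖`, where `‖Φ ⊗ id_n‖` is the norm of
`Φ ⊗ id_n` as a map on matrices with the operator norm. -/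
def cbNorm (Φ : Matrix S S ℂ →ₗ[ℂ] Matrix S S ℂ) : ℝ≥0∞ :=
  ⨆ (n : ℕ) (M : Matrix (S × Fin n) (S × Fin n) ℂ) (_ : ‖M‖ ≤ 1),
    ENNReal.ofReal ‖blockMap n Φ M‖

/-- `L(A) = i[H, A] + ∑_j (K_j* A K_j - ½ {K_j* K_j, A})` for some self-adjoint `H` and finitely
many `K_j`. -/
def IsLindblad (L : Matrix S S ℂ →ₗ[ℂ] Matrix S S ℂ) : Prop :=
  ∃ H : Matrix S S ℂ, H.IsHermitian ∧ ∃ (l : ℕ) (K : Fin l → Matrix S S ℂ), ∀ A : Matrix S S ℂ,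
    L A = Complex.I • (H * A - A * H) +
      ∑ j, (star (K j) * A * K j -
        (1 / 2 : ℂ) • (star (K j) * K j * A + A * (star (K j) * K j)))

/-- States: unital positive linear functionals. -/
structure IsState (π : Matrix S S ℂ →ₗ[ℂ] ℂ) : Prop where
  map_one : π 1 = 1
  nonneg : ∀ M : Matrix S S ℂ, 0 ≤ (π (star M * M)).re ∧ (π (star M * M)).im = 0

end MatrixMaps

/-! ### Quantum spin systems

The Hilbert space at the site `x` is `ℂ ^ (q x)`. An orthonormal basis of the tensor product over
`Λ` is indexed by the configurations on `Λ`, and the algebra of observables in `Λ` consists of the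
operators on that tensor product, written as matrices in this basis, with the operator norm. -/

variable {Γ : Type*} [DecidableEq Γ] {q : Γ → ℕ}

/-- Configurations on `Λ`. -/
abbrev Config (q : Γ → ℕ) (Λ : Finset Γ) : Type _ := (x : Λ) → Fin (q x)

/-- The algebra of observables in `Λ`, with the operator norm. -/
abbrev Obs (q : Γ → ℕ) (Λ : Finset Γ) : Type _ := Matrix (Config q Λ) (Config q Λ) ℂ

/-- Restriction of a configuration to a smaller set. -/
def restrictConfig {Z Λ : Finset Γ} (h : Z ⊆ Λ) (σ : Config q Λ) : Config q Z :=
  fun x => σ ⟨x, h x.2⟩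

/-- The configuration that equals `a` on `Z` and `σ` elsewhere. -/
def overrideConfig {Z Λ : Finset Γ} (σ : Config q Λ) (a : Config q Z) : Config q Λ :=
  fun x => if hx : (x : Γ) ∈ Z then a ⟨x, hx⟩ else σ x

/-- The embedding `A ↦ A ⊗ 1` of the observables in `Z` into those in `Λ`. -/
def embed {Z Λ : Finset Γ} (h : Z ⊆ Λ) (A : Obs q Z) : Obs q Λ :=
  Matrix.of fun σ τ =>
    if ∀ x : Λ, (x : Γ) ∉ Z → σ x = τ x then A (restrictConfig h σ) (restrictConfig h τ) else 0

/-- The extension `Φ ⊗ id` of a linear map on the observables in `Z` to the observables in `Λ`. -/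
def extend {Z Λ : Finset Γ} (h : Z ⊆ Λ) (Φ : Obs q Z →ₗ[ℂ] Obs q Z) : Obs q Λ →ₗ[ℂ] Obs q Λ where
  toFun M := Matrix.of fun σ τ =>
    Φ (Matrix.of fun a b => M (overrideConfig σ a) (overrideConfig τ b))
      (restrictConfig h σ) (restrictConfig h τ)
  map_add' M N := by
    ext σ τ
    exact congrFun (congrFun (Φ.map_add
      (Matrix.of fun a b => M (overrideConfig σ a) (overrideConfig τ b))
      (Matrix.of fun a b => N (overrideConfig σ a) (overrideConfig τ b))) _) _
  map_smul' c M := by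
    ext σ τ
    exact congrFun (congrFun (Φ.map_smul c
      (Matrix.of fun a b => M (overrideConfig σ a) (overrideConfig τ b))) _) _

/-- A dissipative interaction: a linear map of Lindblad form on the observables in `Z`, for every
finite set `Z`. -/
structure DissipativeInteraction (q : Γ → ℕ) where
  map : (Z : Finset Γ) → Obs q Z →ₗ[ℂ] Obs q Z
  lindblad : ∀ Z, IsLindblad (map Z)

/-- The `F`-norm: the infimum of all `M` such that
`∑_{Z ∋ x, y} ‖L_Z‖_cb ≤ M F(d(x, y))` for all `x, y`. -/
def interactionNorm [MetricSpace Γ] (F : ℝ → ℝ) (L : DissipativeInteraction q) : ℝ≥0∞ :=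
  sInf {M : ℝ≥0∞ | ∀ x y : Γ,
    ∑' Z : {Z : Finset Γ // x ∈ Z ∧ y ∈ Z}, cbNorm (L.map Z.1) ≤
      M * ENNReal.ofReal (F (dist x y))}

/-- The finite-volume generator `∑_{Z ⊆ Λ} L_Z`, acting on the observables in `Λ`. -/
def generator (L : DissipativeInteraction q) (Λ : Finset Γ) : Obs q Λ →ₗ[ℂ] Obs q Λ :=
  ∑ Z ∈ Λ.powerset.attach, extend (Finset.mem_powerset.1 Z.2) (L.map Z.1)

/-- The semigroup `exp (t G)` generated by a linear map `G` on a finite-dimensional normed space. -/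
def expSemigroup {E : Type*} [NormedAddCommGroup E] [NormedSpace ℂ E] [FiniteDimensional ℂ E]
    (G : E →ₗ[ℂ] E) (t : ℝ) : E →ₗ[ℂ] E :=
  (NormedSpace.exp ((t : ℂ) • LinearMap.toContinuousLinearMap G) : E →L[ℂ] E).toLinearMap

/-- The finite-volume dynamics `exp (t ∑_{Z ⊆ Λ} L_Z)`. -/
def dynamics (L : DissipativeInteraction q) (Λ : Finset Γ) (t : ℝ) : Obs q Λ →ₗ[ℂ] Obs q Λ :=
  expSemigroup (generator L Λ) t

/-- `π` is a local dynamical fixed point of `L` in `Λ` with convergence governed by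
`g : [0, ∞) → [0, 2]` (the values of `g` at negative times play no role). -/
structure IsLocalDynamicalFixedPoint (L : DissipativeInteraction q) (Λ : Finset Γ)
    (π : Obs q Λ →ₗ[ℂ] ℂ) (g : ℝ → ℝ) : Prop where
  isState : IsState π
  invariant : ∀ t : ℝ, 0 ≤ t → ∀ A : Obs q Λ, π (dynamics L Λ t A) = π A
  range : ∀ t : ℝ, 0 ≤ t → g t ∈ Set.Icc (0 : ℝ) 2
  convergence : ∀ ω : Obs q Λ →ₗ[ℂ] ℂ, IsState ω → ∀ (A : Obs q Λ) (t : ℝ), 0 ≤ t →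
    ‖π (dynamics L Λ t A) - ω (dynamics L Λ t A)‖ ≤ g t * ‖A‖

/-! ### Constants -/

/-- `C_ε = ∑_{n ≥ 0} 1 / (1 + n) ^ (1 + ε)`. -/
def zetaConst (ε : ℝ) : ℝ := ∑' n : ℕ, 1 / (1 + (n : ℝ)) ^ (1 + ε)

/-- `α_ε = α - ν - 1 - ε`. -/
def reducedExponent (α ν ε : ℝ) : ℝ := α - ν - 1 - ε

/-- `C = (κ C_ε / C_F) (κ 2 ^ (2 α_ε) 2 ^ (1 - δ) (C_ε + C_F) + e (C_F + ‖F‖))` for the power law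
`F` of exponent `α`. -/
def localityConst (Γ : Type*) [MetricSpace Γ] (κ ν α ε δ : ℝ) : ℝ :=
  κ * zetaConst ε / (convConst Γ (powerLaw α)).toReal *
    (κ * 2 ^ (2 * reducedExponent α ν ε) * 2 ^ (1 - δ) *
        (zetaConst ε + (convConst Γ (powerLaw α)).toReal) +
      Real.exp 1 * ((convConst Γ (powerLaw α)).toReal + (decaySum Γ (powerLaw α)).toReal))

/-- The velocity `v = ‖L‖_F C_F` for the power law `F` of exponent `α`. -/
def velocity [MetricSpace Γ] (α : ℝ) (L : DissipativeInteraction q) : ℝ :=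
  (interactionNorm (powerLaw α) L).toReal * (convConst Γ (powerLaw α)).toReal

/-- `C' = (3 C / (e v)) 2 ^ ((1 - δ) α_ε - ν - η)`. -/
def correlationConst [MetricSpace Γ] (κ ν α ε δ η : ℝ) (L : DissipativeInteraction q) : ℝ :=
  3 * localityConst Γ κ ν α ε δ / (Real.exp 1 * velocity α L) *
    2 ^ ((1 - δ) * reducedExponent α ν ε - ν - η)

end OpenSpin

end

/-! At a fixed point, `π M` may be replaced by `ω (T M)` at cost `g t * ‖M‖`, where `T` is the
dynamics at time `t` and `ω` is any state. Take for `ω` a diagonal matrix entry in the configuration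
basis: it is a product state, multiplicative on observables localized in disjoint regions
(`IsLocalizedIn.mul_apply_self`). If `T` is further replaced by a dynamics `T'` that does not couple
a neighbourhood of `X` to one of `Y`, then `T' (a * b) = T' a * T' b` (`flow_mul`), so `ω (T' (a *
b)) = ω (T' a) * ω (T' b)`. The correlation is then controlled by three errors `T - T'`, on `a`, `b`
and `a * b`, and three convergence errors.

Let `r` be half the distance of `X` and `Y`. `T'` keeps the sets of diameter at most `R = r ^ (1 -
δ)` inside the `r`-neighbourhood of `X` or that of `Y`; `Ω` is the union of the two. By Duhamel
(`LocalGenerators.norm_flow_sub_flow_le`), `T - T'` is at most `t` times the effect of the removed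
generators on `T'`-evolved observables, and these are of two kinds.

Long sets: the `T'` evolution stays in `Ω`, so only sets meeting `Ω` act. Such a set through `z` has
a point at distance at least `R / 2` from `z`, so the decay of `F` gives `(1 + R / 2) ^ (-α_ε)` per
point of `Ω`, and `Ω` has at most `κ (1 + r) ^ ν (|X| + |Y|)` points.

Short sets: each removed one has a point at distance at least `r` from any given point of `X ∪ Y`.
An interaction of range `R` also decays along `F(d) exp(-d / R)`, with norm larger by a factor `e`
and the same convolution constant, so a Lieb–Robinson bound gives `exp (e v t - r / R)`. At `t = r ^
η / (e v)` the exponent is `r ^ η - r ^ δ ≤ 0`.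

The Lieb–Robinson bound rests on contractivity of all partial dynamics. As `D i` commutes with the
generators of disjoint support, the norms of `D i` on the evolved observable obey a closed system of
Volterra inequalities, for which an explicit profile is a supersolution
(`LocalGenerators.norm_apply_flow_le_lrProfile`). -/

noncomputable section

namespace OpenSpin

/-! ### One-parameter semigroups of bounded operators -/

section Flow

variable {E : Type*} [NormedAddCommGroup E] [NormedSpace ℂ E]

/-- The one-parameter group `exp (t G)` of a bounded operator `G`. -/
def flow (G : E →L[ℂ] E) (t : ℝ) : E →L[ℂ] E := NormedSpace.exp ((t : ℂ) • G)

@[simp] theorem flow_zero (G : E →L[ℂ] E) : flow G 0 = 1 := by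
  simp [flow]

theorem commute_flow {G D : E →L[ℂ] E} (h : Commute D G) (t : ℝ) : Commute D (flow G t) :=
  (h.smul_right (t : ℂ)).exp_right

variable [CompleteSpace E]

theorem hasDerivAt_flow (G : E →L[ℂ] E) (t : ℝ) :
    HasDerivAt (fun s : ℝ => flow G s) (G * flow G t) t := by
  have h := hasDerivAt_exp_smul_const' (𝕂 := ℂ) G (t : ℂ)
  have h2 := h.scomp (𝕜 := ℝ) t (Complex.ofRealCLM.hasDerivAt (x := t))
  simpa [flow, Function.comp_def] using h2

theorem hasDerivAt_flow_apply (G : E →L[ℂ] E) (a : E) (t : ℝ) :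
    HasDerivAt (fun s : ℝ => flow G s a) (G (flow G t a)) t := by
  have h := ((ContinuousLinearMap.apply ℂ E a).restrictScalars ℝ).hasFDerivAt.comp_hasDerivAt t
    (hasDerivAt_flow G t)
  simpa [Function.comp_def] using h

/-- Product rule behind every Duhamel argument below: the interpolation `flow G (t - u) (f u)`
changes only by the defect of `f` from solving `f' = G f`. -/
theorem hasDerivAt_flow_sub_apply (G : E →L[ℂ] E) {f : ℝ → E} {f' : E} {t s : ℝ}
    (hf : HasDerivAt f f' s) :
    HasDerivAt (fun u : ℝ => flow G (t - u) (f u)) (flow G (t - s) (f' - G (f s))) s := by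
  have h1 : HasDerivAt (fun u : ℝ => flow G (t - u)) (-(G * flow G (t - s))) s := by
    have := (hasDerivAt_flow G (t - s)).scomp s ((hasDerivAt_id s).const_sub t)
    simpa [Function.comp_def] using this
  have h1' : HasDerivAt (fun u : ℝ => (flow G (t - u)).restrictScalars ℝ)
      ((-(G * flow G (t - s))).restrictScalars ℝ) s :=
    (ContinuousLinearMap.restrictScalarsL ℂ E E ℝ ℝ).hasFDerivAt.comp_hasDerivAt s h1
  have h2 := h1'.clm_apply hf
  have hc : G * flow G (t - s) = flow G (t - s) * G := (commute_flow (Commute.refl G) (t - s)).eq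
  convert! h2 using 1
  rw [hc]
  simp [sub_eq_neg_add]

theorem flow_add (G : E →L[ℂ] E) (s t : ℝ) : flow G (s + t) = flow G s * flow G t := by
  have : Commute ((s : ℂ) • G) ((t : ℂ) • G) :=
    ((Commute.refl G).smul_left _).smul_right _
  let _ : NormedAlgebra ℚ (E →L[ℂ] E) := NormedAlgebra.restrictScalars ℚ ℂ _
  simp only [flow]
  rw [← NormedSpace.exp_add_of_commute this, ← add_smul, Complex.ofReal_add]

theorem flow_nat_mul (G : E →L[ℂ] E) (n : ℕ) (t : ℝ) : flow G (n * t) = flow G t ^ n := by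
  induction n with
  | zero => simp
  | succ n ih => rw [Nat.cast_succ, add_mul, one_mul, flow_add, ih, pow_succ]

/-- If `‖1 + h G‖ ≤ 1 + c h²` for all `h ≥ 0`, then `exp (t G)` is a contraction for `t ≥ 0`. -/
theorem norm_flow_le_one (G : E →L[ℂ] E) {c : ℝ}
    (hG : ∀ h : ℝ, 0 ≤ h → ‖1 + (h : ℂ) • G‖ ≤ 1 + c * h ^ 2) {t : ℝ} (ht : 0 ≤ t) :
    ‖flow G t‖ ≤ 1 := by
  -- Write `t` as `n + 1` equal steps. Over a short step `h` both the `o(h)` error of the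
  -- first-order expansion and `c * h ^ 2` are absorbed in `ε * h`; finally `ε → 0`.
  have key : ∀ ε : ℝ, 0 < ε → ‖flow G t‖ ≤ Real.exp (ε * t) := by
    intro ε hε
    have h1 := (hasDerivAt_flow G 0).isLittleO
    simp only [flow_zero, mul_one, sub_zero] at h1
    have h1 := h1.def (half_pos hε)
    have h2 : ∀ᶠ h : ℝ in nhds 0, |c * h| ≤ ε / 2 := by
      have : Filter.Tendsto (fun h : ℝ => |c * h|) (nhds 0) (nhds 0) := by
        have : Continuous (fun h : ℝ => |c * h|) := by fun_prop
        simpa using this.tendsto 0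
      exact (this.eventually (gt_mem_nhds (half_pos hε))).mono fun _ h => h.le
    have h3 : ∀ᶠ h : ℝ in nhds 0, 0 ≤ h → ‖flow G h‖ ≤ 1 + ε * h := by
      filter_upwards [h1, h2] with h h1 h2 h0
      have e : flow G h = (flow G h - 1 - h • G) + (1 + (h : ℂ) • G) := by
        rw [Complex.coe_smul]; abel
      have h4 : c * h * h ≤ ε / 2 * h := mul_le_mul_of_nonneg_right ((le_abs_self _).trans h2) h0
      rw [Real.norm_eq_abs, abs_of_nonneg h0] at h1
      rw [e]
      refine (norm_add_le _ _).trans ?_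
      have := hG h h0
      nlinarith
    have h4 : Filter.Tendsto (fun n : ℕ => t / ((n : ℝ) + 1)) Filter.atTop (nhds 0) := by
      have := (tendsto_one_div_add_atTop_nhds_zero_nat (𝕜 := ℝ)).const_mul t
      simpa [div_eq_mul_inv] using this
    obtain ⟨n, hn⟩ := (h4.eventually h3).exists
    have hn0 : (0 : ℝ) ≤ t / ((n : ℝ) + 1) := by positivity
    have e : t = ((n + 1 : ℕ) : ℝ) * (t / ((n : ℝ) + 1)) := by
      push_cast; field_simp
    calc ‖flow G t‖ = ‖flow G (t / ((n : ℝ) + 1)) ^ (n + 1)‖ := by rw [← flow_nat_mul, ← e]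
      _ ≤ ‖flow G (t / ((n : ℝ) + 1))‖ ^ (n + 1) := norm_pow_le' _ (Nat.succ_pos n)
      _ ≤ (Real.exp (ε * (t / ((n : ℝ) + 1)))) ^ (n + 1) := by
          gcongr
          refine (hn hn0).trans ?_
          rw [add_comm]
          exact Real.add_one_le_exp _
      _ = Real.exp (ε * t) := by
          rw [← Real.exp_nat_mul]
          congr 1
          push_cast; field_simp
  have h5 : Filter.Tendsto (fun ε : ℝ => Real.exp (ε * t)) (nhdsWithin 0 (Set.Ioi 0)) (nhds 1) := by
    have : Continuous (fun ε : ℝ => Real.exp (ε * t)) := by fun_prop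
    simpa using (this.tendsto 0).mono_left nhdsWithin_le_nhds
  exact ge_of_tendsto h5 (by filter_upwards [self_mem_nhdsWithin] with ε hε using key ε hε)

end Flow

/-! ### Lindblad generators and states on a matrix algebra -/

section MatrixAlgebra

variable {S : Type*} [Fintype S] [DecidableEq S]

/-- The amplification `A ↦ A ⊗ 1` as a homomorphism of `*`-algebras. -/
def amplify (S : Type*) [Fintype S] [DecidableEq S] (l : ℕ) :
    Matrix S S ℂ →⋆ₐ[ℂ] Matrix (S × Fin l) (S × Fin l) ℂ where
  toFun A := Matrix.blockDiagonal fun _ => A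
  map_one' := Matrix.blockDiagonal_one
  map_mul' A B := Matrix.blockDiagonal_mul (fun _ => A) (fun _ => B)
  map_zero' := Matrix.blockDiagonal_zero
  map_add' A B := Matrix.blockDiagonal_add (fun _ => A) (fun _ => B)
  commutes' c := by
    ext ⟨i, k⟩ ⟨j, m⟩
    simp only [Matrix.blockDiagonal_apply, Matrix.algebraMap_matrix_apply, Prod.mk.injEq]
    by_cases h : i = j <;> by_cases h' : k = m <;> simp [h, h']
  map_star' A := (Matrix.blockDiagonal_conjTranspose _).symm

/-- Stacking the `V j` into one column `W`, the sum is `W* (A ⊗ 1) W`; the amplification is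
contractive and `‖W‖ ^ 2 = ‖W* W‖`. -/
theorem norm_sum_kraus_le {l : ℕ} (V : Fin l → Matrix S S ℂ) (A : Matrix S S ℂ) :
    ‖∑ j, star (V j) * A * V j‖ ≤ ‖∑ j, star (V j) * V j‖ * ‖A‖ := by
  let W : Matrix (S × Fin l) S ℂ := Matrix.of fun p b => V p.2 p.1 b
  have h : ∀ A : Matrix S S ℂ, ∑ j, star (V j) * A * V j = W.conjTranspose * amplify S l A * W := by
    intro A
    ext a b
    simp only [Matrix.sum_apply, Matrix.mul_apply, amplify, StarAlgHom.coe_mk', AlgHom.coe_mk,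
      RingHom.coe_mk, MonoidHom.coe_mk, OneHom.coe_mk, Fintype.sum_prod_type,
      Matrix.blockDiagonal_apply, Matrix.conjTranspose_apply, W, Matrix.of_apply,
      Matrix.star_apply, mul_ite, mul_zero, Finset.sum_ite_eq', Finset.mem_univ, if_true]
    rw [Finset.sum_comm]
  have h1 : ∑ j, star (V j) * V j = W.conjTranspose * W := by
    have := h 1
    rw [map_one, Matrix.mul_one] at this
    simpa using this
  rw [h, h1, Matrix.l2_opNorm_conjTranspose_mul_self]
  have h2 : ‖amplify S l A‖ ≤ ‖A‖ := NonUnitalStarAlgHom.norm_apply_le (amplify S l) A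
  have h3 : ‖W.conjTranspose‖ = ‖W‖ := Matrix.l2_opNorm_conjTranspose W
  calc ‖W.conjTranspose * amplify S l A * W‖
      ≤ ‖W.conjTranspose‖ * ‖amplify S l A‖ * ‖W‖ :=
        (Matrix.l2_opNorm_mul _ _).trans
          (mul_le_mul_of_nonneg_right (Matrix.l2_opNorm_mul _ _) (norm_nonneg _))
    _ ≤ ‖W‖ * ‖A‖ * ‖W‖ := by rw [h3]; gcongr
    _ = ‖W‖ * ‖W‖ * ‖A‖ := by ring

theorem IsLindblad.zero : IsLindblad (0 : Matrix S S ℂ →ₗ[ℂ] Matrix S S ℂ) :=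
  ⟨0, Matrix.isHermitian_zero, 0, Fin.elim0, fun A => by simp⟩

theorem IsLindblad.add {L M : Matrix S S ℂ →ₗ[ℂ] Matrix S S ℂ} (hL : IsLindblad L)
    (hM : IsLindblad M) : IsLindblad (L + M) := by
  obtain ⟨H, hH, l, K, hK⟩ := hL
  obtain ⟨H', hH', l', K', hK'⟩ := hM
  refine ⟨H + H', hH.add hH', l + l', Fin.append K K', fun A => ?_⟩
  rw [LinearMap.add_apply, hK, hK', Fin.sum_univ_add]
  simp only [Fin.append_left, Fin.append_right, add_mul, mul_add]
  simp only [smul_sub, smul_add]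
  abel

theorem IsLindblad.sum {ι : Type*} (s : Finset ι) {L : ι → Matrix S S ℂ →ₗ[ℂ] Matrix S S ℂ}
    (hL : ∀ i ∈ s, IsLindblad (L i)) : IsLindblad (∑ i ∈ s, L i) := by
  classical
  induction s using Finset.induction_on with
  | empty => simpa using IsLindblad.zero
  | insert a s ha ih =>
    rw [Finset.sum_insert ha]
    exact (hL a (Finset.mem_insert_self a s)).add
      (ih fun i hi => hL i (Finset.mem_insert_of_mem hi))

/-- Up to a term of order `h ^ 2`, `1 + h L` is a Kraus map, and `L 1 = 0` makes it unital to the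
same order. This is the input for contractivity of the semigroup. -/
theorem IsLindblad.norm_add_smul_le {L : Matrix S S ℂ →ₗ[ℂ] Matrix S S ℂ} (hL : IsLindblad L) :
    ∃ c : ℝ, ∀ h : ℝ, 0 ≤ h → ∀ A : Matrix S S ℂ,
      ‖A + (h : ℂ) • L A‖ ≤ (1 + c * h ^ 2) * ‖A‖ := by
  obtain ⟨H, hH, l, K, hK⟩ := hL
  have hH' : star H = H := hH
  -- With this `W` the generator reads `W* A + A W + ∑ K* A K`.
  set W : Matrix S S ℂ := -(Complex.I • H) - (1 / 2 : ℂ) • ∑ j, star (K j) * K j with hW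
  have hsK : star (∑ j, star (K j) * K j) = ∑ j, star (K j) * K j := by
    rw [star_sum]; exact Finset.sum_congr rfl fun j _ => by rw [star_mul, star_star]
  have hWs : star W = Complex.I • H - (1 / 2 : ℂ) • ∑ j, star (K j) * K j := by
    rw [hW, star_sub, star_neg, star_smul, star_smul, hH', hsK]
    simp
  have hLW : ∀ A, L A = star W * A + A * W + ∑ j, star (K j) * A * K j := by
    intro A
    rw [hK, hWs, hW, Finset.sum_sub_distrib, ← Finset.smul_sum, Finset.sum_add_distrib,
      ← Finset.sum_mul, ← Finset.mul_sum]
    simp only [sub_mul, mul_sub, mul_neg, smul_mul_assoc, mul_smul_comm, smul_sub, smul_add]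
    abel
  have hL1 : L 1 = 0 := by
    rw [hK]
    simp only [mul_one, one_mul, sub_self, smul_zero, zero_add, ← two_smul ℂ, smul_smul]
    norm_num
  refine ⟨‖W‖ ^ 2 + ‖W‖ ^ 2, fun h hh A => ?_⟩
  have hc : ((Real.sqrt h : ℝ) : ℂ) * (Real.sqrt h : ℝ) = h := by
    rw [← Complex.ofReal_mul, Real.mul_self_sqrt hh]
  -- One step of length `h`: the no-jump operator `1 + h W` and the jumps `√h K j`. Only `h ^ 2 W* A
  -- W` is in excess.
  let V : Fin (l + 1) → Matrix S S ℂ :=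
    Fin.cons (1 + (h : ℂ) • W) fun j => ((Real.sqrt h : ℝ) : ℂ) • K j
  have hV : ∀ A, ∑ j, star (V j) * A * V j =
      A + (h : ℂ) • L A + ((h : ℂ) ^ 2) • (star W * A * W) := by
    intro A
    rw [Fin.sum_univ_succ]
    simp only [V, Fin.cons_zero, Fin.cons_succ, star_add, star_smul, star_one, hLW, smul_add,
      Finset.smul_sum, add_mul, mul_add, one_mul, mul_one, smul_mul_assoc, mul_smul_comm,
      smul_smul, RCLike.star_def, Complex.conj_ofReal, hc, pow_two]
    abel
  have hV1 : ∑ j, star (V j) * V j = 1 + ((h : ℂ) ^ 2) • (star W * W) := by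
    have := hV 1
    rw [hL1] at this
    simpa using this
  have hWA : ‖((h : ℂ) ^ 2) • (star W * A * W)‖ ≤ h ^ 2 * (‖W‖ ^ 2 * ‖A‖) := by
    rw [norm_smul, norm_pow, Complex.norm_real, Real.norm_of_nonneg hh]
    gcongr
    calc ‖star W * A * W‖ ≤ ‖star W‖ * ‖A‖ * ‖W‖ :=
          (norm_mul_le _ _).trans (mul_le_mul_of_nonneg_right (norm_mul_le _ _) (norm_nonneg _))
      _ = ‖W‖ ^ 2 * ‖A‖ := by rw [norm_star]; ring
  -- For an empty index type the identity is zero, so only the inequality holds in general.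
  have hone : ‖(1 : Matrix S S ℂ)‖ ≤ 1 := by
    by_cases hS : Nonempty S
    · rw [CStarRing.norm_one]
    · rw [not_nonempty_iff] at hS
      rw [Subsingleton.elim (1 : Matrix S S ℂ) 0, norm_zero]; exact zero_le_one
  have hWW : ‖1 + ((h : ℂ) ^ 2) • (star W * W)‖ ≤ 1 + h ^ 2 * ‖W‖ ^ 2 := by
    refine (norm_add_le _ _).trans (add_le_add hone ?_)
    rw [norm_smul, norm_pow, Complex.norm_real, Real.norm_of_nonneg hh, CStarRing.norm_star_mul_self,
      pow_two ‖W‖]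
  have e : A + (h : ℂ) • L A =
      ∑ j, star (V j) * A * V j - ((h : ℂ) ^ 2) • (star W * A * W) := by
    rw [hV, add_sub_cancel_right]
  rw [e]
  calc _ ≤ ‖∑ j, star (V j) * A * V j‖ + ‖((h : ℂ) ^ 2) • (star W * A * W)‖ := norm_sub_le _ _
    _ ≤ (1 + h ^ 2 * ‖W‖ ^ 2) * ‖A‖ + h ^ 2 * (‖W‖ ^ 2 * ‖A‖) := by
        refine add_le_add ((norm_sum_kraus_le V A).trans ?_) hWA
        rw [hV1]
        gcongr
    _ = _ := by ring

theorem IsLindblad.norm_flow_le_one {L : Matrix S S ℂ →ₗ[ℂ] Matrix S S ℂ} (hL : IsLindblad L)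
    {t : ℝ} (ht : 0 ≤ t) : ‖flow (LinearMap.toContinuousLinearMap L) t‖ ≤ 1 := by
  obtain ⟨c, hc⟩ := hL.norm_add_smul_le
  refine OpenSpin.norm_flow_le_one _ (c := |c|) (fun h hh => ?_) ht
  refine ContinuousLinearMap.opNorm_le_bound _ (by positivity) fun A => ?_
  refine (hc h hh A).trans ?_
  gcongr
  exact le_abs_self c

/-- Polarization: reality of `π` on the squares of `1 + M` and `1 + i M` fixes the imaginary and
real parts. -/
theorem IsState.map_star {π : Matrix S S ℂ →ₗ[ℂ] ℂ} (hπ : IsState π) (M : Matrix S S ℂ) :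
    π (star M) = star (π M) := by
  have h1 := (hπ.nonneg (1 + M)).2
  have h2 := (hπ.nonneg (1 + Complex.I • M)).2
  have h3 := (hπ.nonneg M).2
  simp only [star_add, star_one, star_smul, add_mul, mul_add, one_mul, mul_one, map_add,
    smul_mul_assoc, mul_smul_comm, map_smul, hπ.map_one] at h1 h2
  simp [h3] at h1 h2
  apply Complex.ext <;> simp <;> linarith

-- Positivity on the square of `‖N‖ - N`, with `N* N ≤ ‖N‖ ^ 2`, gives `Re π(N) ≤ ‖N‖`; rotating the
-- phase of `M` turns the real part into the modulus.
open scoped MatrixOrder in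
theorem IsState.norm_apply_le {π : Matrix S S ℂ →ₗ[ℂ] ℂ} (hπ : IsState π) (M : Matrix S S ℂ) :
    ‖π M‖ ≤ ‖M‖ := by
  have hre : ∀ N : Matrix S S ℂ, (π N).re ≤ ‖N‖ := by
    intro N
    rcases (norm_nonneg N).eq_or_lt with h0 | h0
    · rw [norm_eq_zero.1 h0.symm]; simp
    have hle : star N * N ≤ algebraMap ℝ (Matrix S S ℂ) (‖N‖ ^ 2) :=
      CStarAlgebra.star_mul_le_algebraMap_norm_sq
    obtain ⟨P, hP⟩ := CStarAlgebra.nonneg_iff_eq_star_mul_self.1 (sub_nonneg.2 hle)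
    have h1 := (hπ.nonneg P).1
    rw [← hP, map_sub, Algebra.algebraMap_eq_smul_one, ← Complex.coe_smul, map_smul,
      hπ.map_one] at h1
    have h2 := (hπ.nonneg ((‖N‖ : ℂ) • (1 : Matrix S S ℂ) - N)).1
    simp only [star_sub, star_smul, star_one, sub_mul, mul_sub, smul_mul_assoc, mul_smul_comm,
      one_mul, mul_one, map_sub, map_smul, hπ.map_one, hπ.map_star] at h2
    simp at h1 h2
    norm_cast at h1
    nlinarith
  rcases eq_or_ne (π M) 0 with h0 | h0
  · rw [h0, norm_zero]; exact norm_nonneg _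
  have hn : ‖π M‖ ≠ 0 := norm_ne_zero_iff.2 h0
  have h := hre ((star (π M) / ‖π M‖) • M)
  have hu : ‖star (π M) / (‖π M‖ : ℂ)‖ = 1 := by
    rw [norm_div, norm_star, Complex.norm_real, norm_norm, div_self hn]
  rw [norm_smul, hu, one_mul, map_smul, smul_eq_mul] at h
  have e : star (π M) / (‖π M‖ : ℂ) * π M = (‖π M‖ : ℝ) := by
    rw [div_mul_eq_mul_div, RCLike.star_def, Complex.conj_mul']
    field_simp
  rwa [e, Complex.ofReal_re] at h

end MatrixAlgebra

/-! ### Completely bounded maps -/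

section CompletelyBounded

variable {S : Type*} [Fintype S] [DecidableEq S]

theorem norm_submatrix_equiv_le {m n : Type*} [Fintype m] [DecidableEq m] [Fintype n]
    [DecidableEq n] (e : m ≃ n) (M : Matrix n n ℂ) : ‖M.submatrix e e‖ ≤ ‖M‖ := by
  let f : Matrix n n ℂ →⋆ₐ[ℂ] Matrix m m ℂ :=
    { (Matrix.reindexAlgEquiv ℂ ℂ e.symm).toAlgHom with
      map_star' := fun A => by
        ext i j
        simp [Matrix.star_apply] }
  exact NonUnitalStarAlgHom.norm_apply_le f M

/-- Homogeneity extends the supremum over the unit ball to all matrices; finiteness makes `toReal`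
faithful. -/
theorem norm_blockMap_le {Φ : Matrix S S ℂ →ₗ[ℂ] Matrix S S ℂ} (hΦ : cbNorm Φ < ⊤) (n : ℕ)
    (M : Matrix (S × Fin n) (S × Fin n) ℂ) : ‖blockMap n Φ M‖ ≤ (cbNorm Φ).toReal * ‖M‖ := by
  have hsmul : ∀ (c : ℂ) (N : Matrix (S × Fin n) (S × Fin n) ℂ),
      blockMap n Φ (c • N) = c • blockMap n Φ N := by
    intro c N
    ext p r
    exact congrFun (congrFun (Φ.map_smul c (Matrix.of fun a b => N (a, p.2) (b, r.2))) _) _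
  have hunit : ∀ N : Matrix (S × Fin n) (S × Fin n) ℂ, ‖N‖ ≤ 1 →
      ‖blockMap n Φ N‖ ≤ (cbNorm Φ).toReal := by
    intro N hN
    refine (ENNReal.ofReal_le_iff_le_toReal hΦ.ne).1 ?_
    exact le_iSup_of_le n (le_iSup_of_le N (le_iSup_of_le hN le_rfl))
  rcases eq_or_ne M 0 with rfl | h0
  · have : blockMap n Φ 0 = 0 := by simpa using hsmul 0 0
    simp [this]
  have hn : ‖M‖ ≠ 0 := norm_ne_zero_iff.2 h0
  have h1 := hunit (((‖M‖⁻¹ : ℝ) : ℂ) • M) (by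
    rw [norm_smul, Complex.norm_real, norm_inv, norm_norm, inv_mul_cancel₀ hn])
  rw [hsmul, norm_smul, Complex.norm_real, norm_inv, norm_norm,
    inv_mul_le_iff₀ (norm_pos_iff.2 h0)] at h1
  rwa [mul_comm]

end CompletelyBounded

/-! ### Local observables and local maps -/

section Local

variable {Γ : Type*} [DecidableEq Γ] {q : Γ → ℕ} {Z W Λ : Finset Γ}

@[simp] theorem restrictConfig_overrideConfig (h : Z ⊆ Λ) (σ : Config q Λ) (a : Config q Z) :
    restrictConfig h (overrideConfig σ a) = a := by
  ext x
  simp [restrictConfig, overrideConfig]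

theorem overrideConfig_of_notMem (σ : Config q Λ) (a : Config q Z) {x : Λ} (hx : (x : Γ) ∉ Z) :
    overrideConfig σ a x = σ x := by
  simp [overrideConfig, hx]

theorem overrideConfig_restrictConfig (h : Z ⊆ Λ) {σ τ : Config q Λ}
    (hst : ∀ x : Λ, (x : Γ) ∉ Z → σ x = τ x) : overrideConfig σ (restrictConfig h τ) = τ := by
  ext x
  by_cases hx : (x : Γ) ∈ Z
  · simp [overrideConfig, restrictConfig, hx]
  · rw [overrideConfig_of_notMem _ _ hx, hst x hx]

theorem overrideConfig_injective (h : Z ⊆ Λ) (σ : Config q Λ) :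
    Function.Injective (overrideConfig σ : Config q Z → Config q Λ) := fun a b hab => by
  rw [← restrictConfig_overrideConfig h σ a, hab, restrictConfig_overrideConfig]

theorem embed_apply_overrideConfig (h : Z ⊆ Λ) (B : Obs q Z) (σ : Config q Λ) (a : Config q Z) :
    embed h B σ (overrideConfig σ a) = B (restrictConfig h σ) a := by
  rw [embed, Matrix.of_apply, if_pos, restrictConfig_overrideConfig]
  exact fun x hx => (overrideConfig_of_notMem σ a hx).symm

theorem embed_apply_overrideConfig_left (h : Z ⊆ Λ) (B : Obs q Z) (σ : Config q Λ)
    (a : Config q Z) : embed h B (overrideConfig σ a) σ = B a (restrictConfig h σ) := by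
  rw [embed, Matrix.of_apply, if_pos, restrictConfig_overrideConfig]
  exact fun x hx => overrideConfig_of_notMem σ a hx

/-- The row `σ` of `B ⊗ 1` is supported on configurations agreeing with `σ` off `Z`, and these are
parametrized by their values on `Z`. -/
theorem embed_mul_apply (h : Z ⊆ Λ) (B : Obs q Z) (M : Obs q Λ) (σ τ : Config q Λ) :
    (embed h B * M) σ τ = ∑ a, B (restrictConfig h σ) a * M (overrideConfig σ a) τ := by
  rw [Matrix.mul_apply]
  symm
  refine Finset.sum_of_injOn (overrideConfig σ) (overrideConfig_injective h σ).injOn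
    (by simp) (fun ρ _ hρ => ?_) (fun a _ => by rw [embed_apply_overrideConfig])
  rw [embed, Matrix.of_apply, if_neg, zero_mul]
  intro hc
  exact hρ ⟨restrictConfig h ρ, by simp, overrideConfig_restrictConfig h hc⟩

theorem mul_embed_apply (h : Z ⊆ Λ) (B : Obs q Z) (M : Obs q Λ) (σ τ : Config q Λ) :
    (M * embed h B) σ τ = ∑ b, M σ (overrideConfig τ b) * B b (restrictConfig h τ) := by
  rw [Matrix.mul_apply]
  symm
  refine Finset.sum_of_injOn (overrideConfig τ) (overrideConfig_injective h τ).injOn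
    (by simp) (fun ρ _ hρ => ?_) (fun a _ => by rw [embed_apply_overrideConfig_left])
  rw [embed, Matrix.of_apply, if_neg, mul_zero]
  intro hc
  exact hρ ⟨restrictConfig h ρ, by simp, overrideConfig_restrictConfig h fun x hx => (hc x hx).symm⟩

theorem embed_mul (h : Z ⊆ Λ) (A B : Obs q Z) : embed h (A * B) = embed h A * embed h B := by
  ext σ τ
  rw [embed_mul_apply]
  simp only [embed, Matrix.of_apply, restrictConfig_overrideConfig, Matrix.mul_apply]
  have : ∀ a : Config q Z, (∀ x : Λ, (x : Γ) ∉ Z → overrideConfig σ a x = τ x) ↔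
      ∀ x : Λ, (x : Γ) ∉ Z → σ x = τ x := fun a =>
    forall₂_congr fun x hx => by rw [overrideConfig_of_notMem _ _ hx]
  simp only [this]
  split_ifs <;> simp

theorem embed_one (h : Z ⊆ Λ) : embed h (1 : Obs q Z) = 1 := by
  ext σ τ
  rw [embed, Matrix.of_apply, Matrix.one_apply, Matrix.one_apply, ← ite_and]
  refine if_congr ⟨fun ⟨h1, h2⟩ => ?_, ?_⟩ rfl rfl
  · rw [← overrideConfig_restrictConfig h h1, ← h2]
    exact (overrideConfig_restrictConfig h fun _ _ => rfl).symm
  · rintro rfl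
    exact ⟨fun _ _ => rfl, rfl⟩

theorem embed_star (h : Z ⊆ Λ) (A : Obs q Z) : embed h (star A) = star (embed h A) := by
  ext σ τ
  simp only [embed, Matrix.of_apply, Matrix.star_apply, eq_comm (a := τ _)]
  split_ifs <;> simp

/-- The embedding `A ↦ A ⊗ 1` as a homomorphism of `*`-algebras. -/
def embedHom (h : Z ⊆ Λ) : Obs q Z →⋆ₐ[ℂ] Obs q Λ where
  toFun := embed h
  map_one' := embed_one h
  map_mul' := embed_mul h
  map_zero' := by ext; simp [embed]
  map_add' A B := by
    ext σ τ
    simp only [embed, Matrix.of_apply, Matrix.add_apply]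
    split_ifs <;> simp
  commutes' c := by
    rw [Algebra.algebraMap_eq_smul_one, Algebra.algebraMap_eq_smul_one, ← embed_one h]
    ext σ τ
    simp only [embed, Matrix.of_apply, Matrix.smul_apply]
    split_ifs <;> simp
  map_star' := embed_star h

theorem norm_embed_le (h : Z ⊆ Λ) (A : Obs q Z) : ‖embed h A‖ ≤ ‖A‖ :=
  NonUnitalStarAlgHom.norm_apply_le (embedHom h) A

/-- This entry formula does not depend on the order of the two factors, hence the commutation of
observables with disjoint supports. -/
theorem embed_mul_embed_apply (hZ : Z ⊆ Λ) (hW : W ⊆ Λ) (hd : Disjoint Z W) (A : Obs q Z)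
    (B : Obs q W) (σ τ : Config q Λ) :
    (embed hZ A * embed hW B) σ τ = if ∀ x : Λ, (x : Γ) ∉ Z → (x : Γ) ∉ W → σ x = τ x then
      A (restrictConfig hZ σ) (restrictConfig hZ τ) *
        B (restrictConfig hW σ) (restrictConfig hW τ) else 0 := by
  have hrW : ∀ a : Config q Z, restrictConfig hW (overrideConfig σ a) = restrictConfig hW σ := by
    intro a
    ext x
    have hx : (x : Γ) ∉ Z := fun hx => Finset.disjoint_left.1 hd hx x.2
    simp [restrictConfig, overrideConfig, hx]
  rw [embed_mul_apply, Finset.sum_eq_single (restrictConfig hZ τ)]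
  · rw [embed, Matrix.of_apply, hrW, mul_ite, mul_zero]
    refine if_congr ⟨fun h x hx hx' => ?_, fun h x hx => ?_⟩ rfl rfl
    · rw [← h x hx', overrideConfig_of_notMem _ _ hx]
    · by_cases hxZ : (x : Γ) ∈ Z
      · simp [overrideConfig, restrictConfig, hxZ]
      · rw [overrideConfig_of_notMem _ _ hxZ, h x hxZ hx]
  · intro a _ ha
    rw [embed, Matrix.of_apply, if_neg, mul_zero]
    intro h
    apply ha
    ext x
    have hx : (x : Γ) ∉ W := Finset.disjoint_left.1 hd x.2
    have := h ⟨x, hZ x.2⟩ hx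
    simp only [overrideConfig, x.2, dif_pos] at this
    rw [restrictConfig, ← this]
  · simp

theorem commute_embed (hZ : Z ⊆ Λ) (hW : W ⊆ Λ) (hd : Disjoint Z W) (A : Obs q Z) (B : Obs q W) :
    Commute (embed hZ A) (embed hW B) := by
  ext σ τ
  rw [embed_mul_embed_apply hZ hW hd, embed_mul_embed_apply hW hZ hd.symm]
  refine if_congr ⟨fun h x h1 h2 => h x h2 h1, fun h x h1 h2 => h x h2 h1⟩ (mul_comm _ _) rfl

theorem extend_apply (h : Z ⊆ Λ) (Φ : Obs q Z →ₗ[ℂ] Obs q Z) (M : Obs q Λ) (σ τ : Config q Λ) :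
    extend h Φ M σ τ = Φ (Matrix.of fun a b => M (overrideConfig σ a) (overrideConfig τ b))
      (restrictConfig h σ) (restrictConfig h τ) := rfl

theorem embed_mul_mul_embed_apply (h : Z ⊆ Λ) (B C : Obs q Z) (M : Obs q Λ) (σ τ : Config q Λ) :
    (embed h B * M * embed h C) σ τ =
      (B * (Matrix.of fun a b => M (overrideConfig σ a) (overrideConfig τ b)) * C : Obs q Z)
        (restrictConfig h σ) (restrictConfig h τ) := by
  rw [mul_embed_apply, Matrix.mul_apply]
  refine Finset.sum_congr rfl fun b _ => ?_
  rw [embed_mul_apply, Matrix.mul_apply]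
  rfl

/-- Blockwise, multiplication by `B ⊗ 1` is multiplication by `B`, so the Lindblad form survives
extension with embedded coefficients. All algebraic properties of the extension are read off from
it. -/
theorem extend_lindblad (h : Z ⊆ Λ) {Φ : Obs q Z →ₗ[ℂ] Obs q Z} (hΦ : IsLindblad Φ) :
    ∃ H : Obs q Z, H.IsHermitian ∧ ∃ (l : ℕ) (K : Fin l → Obs q Z), ∀ A : Obs q Λ,
      extend h Φ A = Complex.I • (embed h H * A - A * embed h H) +
        ∑ j, (star (embed h (K j)) * A * embed h (K j) -
          (1 / 2 : ℂ) • (star (embed h (K j)) * embed h (K j) * A +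
            A * (star (embed h (K j)) * embed h (K j)))) := by
  obtain ⟨H, hH, l, K, hK⟩ := hΦ
  refine ⟨H, hH, l, K, fun A => ?_⟩
  ext σ τ
  rw [extend_apply, hK]
  have h1 : ∀ B : Obs q Z, (embed h B * A) σ τ =
      (B * (Matrix.of fun a b => A (overrideConfig σ a) (overrideConfig τ b)) : Obs q Z)
        (restrictConfig h σ) (restrictConfig h τ) := fun B => by
    simpa [embed_one] using embed_mul_mul_embed_apply h B 1 A σ τ
  have h2 : ∀ B : Obs q Z, (A * embed h B) σ τ =
      ((Matrix.of fun a b => A (overrideConfig σ a) (overrideConfig τ b)) * B : Obs q Z)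
        (restrictConfig h σ) (restrictConfig h τ) := fun B => by
    simpa [embed_one] using embed_mul_mul_embed_apply h 1 B A σ τ
  simp only [Matrix.add_apply, Matrix.smul_apply, Matrix.sub_apply, Matrix.sum_apply,
    ← embed_star, ← embed_mul, embed_mul_mul_embed_apply, h1, h2]

theorem isLindblad_extend (h : Z ⊆ Λ) {Φ : Obs q Z →ₗ[ℂ] Obs q Z} (hΦ : IsLindblad Φ) :
    IsLindblad (extend h Φ) := by
  obtain ⟨H, hH, l, K, hK⟩ := extend_lindblad h hΦ
  refine ⟨embed h H, ?_, l, fun j => embed h (K j), hK⟩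
  have := embed_star h H
  rw [Matrix.star_eq_conjTranspose, hH.eq] at this
  exact this.symm

/-- An element commuting with all Lindblad coefficients can be pulled out of each term: the
extension is a module map over the commutant of the observables in `Z`. -/
theorem extend_mul_right (h : Z ⊆ Λ) {Φ : Obs q Z →ₗ[ℂ] Obs q Z} (hΦ : IsLindblad Φ)
    {N : Obs q Λ} (hN : ∀ B : Obs q Z, Commute (embed h B) N) (M : Obs q Λ) :
    extend h Φ (M * N) = extend h Φ M * N := by
  obtain ⟨H, -, l, K, hK⟩ := extend_lindblad h hΦ
  have hc : ∀ (B : Obs q Z) (P : Obs q Λ), P * N * embed h B = P * embed h B * N := fun B P => by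
    rw [mul_assoc, ← (hN B).eq, mul_assoc]
  simp only [hK, ← embed_star, ← embed_mul, add_mul, Finset.sum_mul, sub_mul, smul_mul_assoc,
    hc, ← mul_assoc]

theorem extend_mul_left (h : Z ⊆ Λ) {Φ : Obs q Z →ₗ[ℂ] Obs q Z} (hΦ : IsLindblad Φ)
    {N : Obs q Λ} (hN : ∀ B : Obs q Z, Commute (embed h B) N) (M : Obs q Λ) :
    extend h Φ (N * M) = N * extend h Φ M := by
  obtain ⟨H, -, l, K, hK⟩ := extend_lindblad h hΦ
  have hc : ∀ (B : Obs q Z) (P : Obs q Λ), embed h B * (N * P) = N * (embed h B * P) :=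
    fun B P => by rw [← mul_assoc, (hN B).eq, mul_assoc]
  simp only [hK, ← embed_star, ← embed_mul, mul_add, Finset.mul_sum, mul_sub, mul_smul_comm,
    hc, mul_assoc]

theorem extend_eq_zero_of_commute (h : Z ⊆ Λ) {Φ : Obs q Z →ₗ[ℂ] Obs q Z} (hΦ : IsLindblad Φ)
    {N : Obs q Λ} (hN : ∀ B : Obs q Z, Commute (embed h B) N) : extend h Φ N = 0 := by
  have h1 : extend h Φ (1 : Obs q Λ) = 0 := by
    obtain ⟨H, -, l, K, hK⟩ := extend_lindblad h hΦ
    rw [hK]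
    simp only [mul_one, one_mul, sub_self, smul_zero, zero_add, ← two_smul ℂ, smul_smul]
    norm_num
  simpa [h1] using extend_mul_right h hΦ hN 1

theorem commute_extend_apply (h : Z ⊆ Λ) {Φ : Obs q Z →ₗ[ℂ] Obs q Z} (hΦ : IsLindblad Φ)
    {N M : Obs q Λ} (hN : ∀ B : Obs q Z, Commute (embed h B) N) (hM : Commute N M) :
    Commute N (extend h Φ M) := by
  rw [Commute, SemiconjBy, ← extend_mul_left h hΦ hN, ← extend_mul_right h hΦ hN, hM.eq]

/-- Observables on the empty set are scalars. This case is separate because the interaction norm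
sees only sets containing a point and says nothing about `L.map ∅`. -/
theorem extend_empty {Φ : Obs q (∅ : Finset Γ) →ₗ[ℂ] Obs q (∅ : Finset Γ)} (hΦ : IsLindblad Φ)
    (h : ∅ ⊆ Λ) : extend h Φ = 0 := by
  ext1 N
  refine extend_eq_zero_of_commute h hΦ fun B => ?_
  have hB : B = B default default • (1 : Obs q (∅ : Finset Γ)) := by
    ext i j
    rw [Subsingleton.elim i default, Subsingleton.elim j default]
    simp
  have : embed h B = B default default • (1 : Obs q Λ) := by
    rw [← embed_one h]
    conv_lhs => rw [hB]
    exact map_smul (embedHom h) _ _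
  rw [this]
  exact (Commute.one_left N).smul_left _

/-- The coefficients of the second generator lie in the commutant of the observables in `Z`, so they
pass through the first. -/
theorem extend_comm (hZ : Z ⊆ Λ) (hW : W ⊆ Λ) (hd : Disjoint Z W) {Φ : Obs q Z →ₗ[ℂ] Obs q Z}
    (hΦ : IsLindblad Φ) {Ψ : Obs q W →ₗ[ℂ] Obs q W} (hΨ : IsLindblad Ψ) (M : Obs q Λ) :
    extend hZ Φ (extend hW Ψ M) = extend hW Ψ (extend hZ Φ M) := by
  obtain ⟨H, -, l, K, hK⟩ := extend_lindblad hW hΨ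
  have hr : ∀ (B : Obs q W) (P : Obs q Λ),
      extend hZ Φ (P * embed hW B) = extend hZ Φ P * embed hW B := fun B P =>
    extend_mul_right hZ hΦ (fun C => commute_embed hZ hW hd C B) P
  have hl : ∀ (B : Obs q W) (P : Obs q Λ),
      extend hZ Φ (embed hW B * P) = embed hW B * extend hZ Φ P := fun B P =>
    extend_mul_left hZ hΦ (fun C => commute_embed hZ hW hd C B) P
  simp only [hK, ← embed_star, ← embed_mul, map_add, map_sum, map_sub, map_smul, hr, hl]

/-- The configurations on `Λ` are pairs of configurations on `Z` and on `Λ \ Z`. -/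
def splitConfig (h : Z ⊆ Λ) : Config q Λ ≃ Config q Z × Config q (Λ \ Z) where
  toFun σ := (restrictConfig h σ, restrictConfig Finset.sdiff_subset σ)
  invFun p x := if hx : (x : Γ) ∈ Z then p.1 ⟨x, hx⟩ else p.2 ⟨x, by simp [hx]⟩
  left_inv σ := by
    ext x
    by_cases hx : (x : Γ) ∈ Z <;> simp [restrictConfig, hx]
  right_inv p := by
    refine Prod.ext (funext fun x => by simp [restrictConfig]) (funext fun x => ?_)
    have hx : (x : Γ) ∉ Z := (Finset.mem_sdiff.1 x.2).2
    simp [restrictConfig, hx]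

/-- Numbering the configurations on `Λ \ Z` identifies the extension with a block map, which the
completely bounded norm controls uniformly in the block size. -/
theorem norm_extend_le (h : Z ⊆ Λ) {Φ : Obs q Z →ₗ[ℂ] Obs q Z} (hΦ : cbNorm Φ < ⊤) (M : Obs q Λ) :
    ‖extend h Φ M‖ ≤ (cbNorm Φ).toReal * ‖M‖ := by
  let e := (splitConfig h (q := q)).trans
    ((Equiv.refl _).prodCongr (Fintype.equivFin (Config q (Λ \ Z))))
  have he : ∀ (σ : Config q Λ) (a : Config q Z),
      e.symm (a, (e σ).2) = overrideConfig σ a := by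
    intro σ a
    ext x
    by_cases hx : (x : Γ) ∈ Z <;>
      simp [e, splitConfig, overrideConfig, restrictConfig, hx]
  have hext : extend h Φ M =
      (blockMap _ Φ (M.submatrix e.symm e.symm)).submatrix e e := by
    ext σ τ
    simp only [extend_apply, Matrix.submatrix_apply, blockMap, Matrix.of_apply, he]
    rfl
  rw [hext]
  calc _ ≤ ‖blockMap _ Φ (M.submatrix e.symm e.symm)‖ := norm_submatrix_equiv_le e _
    _ ≤ (cbNorm Φ).toReal * ‖M.submatrix e.symm e.symm‖ := norm_blockMap_le hΦ _ _
    _ ≤ _ := by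
      gcongr
      exact norm_submatrix_equiv_le e.symm M

end Local

/-! ### Locality estimates for semigroups with local generators -/

section Locality

/-- Comparison of a subsolution `u` and a supersolution `w` of a linear system of Volterra
inequalities with nonnegative coefficients. -/
theorem le_of_volterra_inequality {ι : Type*} (I : Finset ι) {u w w' : ι → ℝ → ℝ} {b c : ι → ℝ}
    {N : ι → Finset ι} (hN : ∀ i, N i ⊆ I) (hc : ∀ i, 0 ≤ c i) (hu : ∀ i, Continuous (u i))
    (hw : ∀ i s, HasDerivAt (w i) (w' i s) s) (hw'c : ∀ i, Continuous (w' i))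
    (hsub : ∀ i ∈ I, ∀ s, 0 ≤ s → u i s ≤ b i + c i * ∫ r in (0 : ℝ)..s, ∑ j ∈ N i, u j r)
    (hsup : ∀ i ∈ I, ∀ s, 0 ≤ s → c i * ∑ j ∈ N i, w j s ≤ w' i s)
    (hb : ∀ i ∈ I, b i ≤ w i 0) {i : ι} (hi : i ∈ I) {s : ℝ} (hs : 0 ≤ s) : u i s ≤ w i s := by
  have hwc : ∀ i, Continuous (w i) := fun i =>
    continuous_iff_continuousAt.2 fun s => (hw i s).continuousAt
  -- Total excess of `u` over `w`. Its primitive `Q` satisfies `Q' ≤ (∑ c) Q` and `Q 0 = 0`, so it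
  -- vanishes by Grönwall.
  set P : ℝ → ℝ := fun s => ∑ j ∈ I, max (u j s - w j s) 0 with hP
  have hPc : Continuous P := continuous_finsetSum _ fun j _ =>
    ((hu j).sub (hwc j)).max continuous_const
  have hP0 : ∀ s, 0 ≤ P s := fun s => Finset.sum_nonneg fun j _ => le_max_right _ _
  set Q : ℝ → ℝ := fun s => ∫ r in (0 : ℝ)..s, P r with hQ
  have hQd : ∀ s, HasDerivAt Q (P s) s := fun s => (hPc.integral_hasStrictDerivAt 0 s).hasDerivAt
  have hQ0 : ∀ s, 0 ≤ s → 0 ≤ Q s := fun s hs =>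
    intervalIntegral.integral_nonneg hs fun r _ => hP0 r
  have hdiff : ∀ i ∈ I, ∀ s, 0 ≤ s → u i s - w i s ≤ c i * Q s := by
    intro i hi s hs
    have hwi : w i s - w i 0 = ∫ r in (0 : ℝ)..s, w' i r :=
      (intervalIntegral.integral_eq_sub_of_hasDerivAt (fun r _ => hw i r)
        ((hw'c i).intervalIntegrable _ _)).symm
    have h1 : ∫ r in (0 : ℝ)..s, c i * ∑ j ∈ N i, u j r ≤
        ∫ r in (0 : ℝ)..s, (w' i r + c i * P r) := by
      refine intervalIntegral.integral_mono_on hs ?_ ?_ fun r hr => ?_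
      · exact (continuous_const.mul (continuous_finsetSum _ fun j _ => hu j)).intervalIntegrable _ _
      · exact ((hw'c i).add (continuous_const.mul hPc)).intervalIntegrable _ _
      · have h2 : ∑ j ∈ N i, u j r ≤ ∑ j ∈ N i, w j r + P r := by
          rw [← sub_le_iff_le_add', ← Finset.sum_sub_distrib]
          calc ∑ j ∈ N i, (u j r - w j r) ≤ ∑ j ∈ N i, max (u j r - w j r) 0 :=
                Finset.sum_le_sum fun j _ => le_max_left _ _
            _ ≤ P r := Finset.sum_le_sum_of_subset_of_nonneg (hN i) fun j _ _ => le_max_right _ _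
        have h3 := mul_le_mul_of_nonneg_left h2 (hc i)
        have h4 := hsup i hi r hr.1
        rw [mul_add] at h3
        linarith
    have hcP : Continuous fun r => c i * P r := continuous_const.mul hPc
    rw [intervalIntegral.integral_const_mul, intervalIntegral.integral_add
      ((hw'c i).intervalIntegrable _ _) (hcP.intervalIntegrable _ _),
      intervalIntegral.integral_const_mul, ← hwi] at h1
    have h5 := hsub i hi s hs
    have h6 := hb i hi
    linarith
  have hPQ : ∀ s, 0 ≤ s → P s ≤ (∑ j ∈ I, c j) * Q s := by
    intro s hs
    rw [Finset.sum_mul]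
    exact Finset.sum_le_sum fun j hj =>
      max_le (hdiff j hj s hs) (mul_nonneg (hc j) (hQ0 s hs))
  have hQz : Q s = 0 := by
    refine eq_zero_of_abs_deriv_le_mul_abs_self_of_eq_zero_right (f' := P) (K := ∑ j ∈ I, c j)
      (a := 0) (b := s) (fun r _ => (hQd r).continuousAt.continuousWithinAt)
      (fun r _ => (hQd r).hasDerivWithinAt) (by simp [hQ]) (fun r hr => ?_) s ⟨hs, le_rfl⟩
    rw [Real.norm_of_nonneg (hP0 r), Real.norm_of_nonneg (hQ0 r hr.1)]
    exact hPQ r hr.1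
  have := hdiff i hi s hs
  rw [hQz, mul_zero] at this
  linarith

variable {Γ : Type*} {E : Type*} [NormedAddCommGroup E] [NormedSpace ℂ E]

/-- Bounded operators `D i` localized in finite subsets `supp i` of `Λ`, with norms at most `c i`,
such that every partial sum generates a contraction semigroup. -/
structure LocalGenerators {ι : Type*} (D : ι → E →L[ℂ] E) (supp : ι → Finset Γ) (c : ι → ℝ)
    (Λ : Finset Γ) : Prop where
  nonneg : ∀ i, 0 ≤ c i
  norm_le : ∀ i a, ‖D i a‖ ≤ c i * ‖a‖
  supp_subset : ∀ i, supp i ⊆ Λ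
  commute : ∀ i j, Disjoint (supp i) (supp j) → Commute (D i) (D j)
  contraction : ∀ (J : Finset ι) (s : ℝ), 0 ≤ s → ‖flow (∑ j ∈ J, D j) s‖ ≤ 1

variable {ι : Type*} {D : ι → E →L[ℂ] E} {supp : ι → Finset Γ}
  {c : ι → ℝ} {Λ : Finset Γ}

theorem LocalGenerators.norm_flow_apply_le (hD : LocalGenerators D supp c Λ) (J : Finset ι) {s : ℝ}
    (hs : 0 ≤ s) (a : E) : ‖flow (∑ j ∈ J, D j) s a‖ ≤ ‖a‖ := by
  simpa using ContinuousLinearMap.le_of_opNorm_le _ (hD.contraction J s hs) a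

/-- Generators whose support misses `Ω` annihilate what evolves inside `Ω`; the others are
counted by their intersection points with `Ω`. -/
theorem LocalGenerators.sum_norm_apply_flow_le_of_subset [DecidableEq Γ] (hD : LocalGenerators D supp c Λ)
    {J K : Finset ι} {X Ω : Finset Γ} (hXΩ : X ⊆ Ω) (hJΩ : ∀ j ∈ J, supp j ⊆ Ω)
    {a : E} (ha : ∀ i, Disjoint (supp i) X → D i a = 0) {s : ℝ} (hs : 0 ≤ s) :
    ∑ i ∈ K, ‖D i (flow (∑ j ∈ J, D j) s a)‖ ≤
      ‖a‖ * ∑ z ∈ Ω, ∑ i ∈ K with z ∈ supp i, c i := by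
  have e : ‖a‖ * ∑ z ∈ Ω, ∑ i ∈ K with z ∈ supp i, c i =
      ∑ i ∈ K, ∑ z ∈ Ω, if z ∈ supp i then c i * ‖a‖ else 0 := by
    rw [Finset.sum_comm, Finset.mul_sum]
    refine Finset.sum_congr rfl fun z _ => ?_
    rw [Finset.sum_filter, Finset.mul_sum]
    refine Finset.sum_congr rfl fun i _ => ?_
    split_ifs <;> ring
  rw [e]
  refine Finset.sum_le_sum fun i _ => ?_
  have hterm : 0 ≤ c i * ‖a‖ := mul_nonneg (hD.nonneg i) (norm_nonneg a)
  by_cases hd : Disjoint (supp i) Ω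
  · have hcomm : Commute (D i) (∑ j ∈ J, D j) := Commute.sum_right _ _ _ fun j hj =>
      hD.commute i j (hd.mono_right (hJΩ j hj))
    have h1 : D i (flow (∑ j ∈ J, D j) s a) = flow (∑ j ∈ J, D j) s (D i a) :=
      DFunLike.congr_fun (commute_flow hcomm s).eq a
    rw [h1, ha i (hd.mono_right hXΩ), map_zero, norm_zero]
    exact Finset.sum_nonneg fun z _ => by split_ifs; exacts [hterm, le_rfl]
  · obtain ⟨z, hz, hz'⟩ := Finset.not_disjoint_iff.1 hd
    refine (hD.norm_le _ _).trans ((mul_le_mul_of_nonneg_left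
      (hD.norm_flow_apply_le J hs a) (hD.nonneg i)).trans ?_)
    refine le_trans (le_of_eq ?_) (Finset.single_le_sum (f := fun z =>
      if z ∈ supp i then c i * ‖a‖ else 0) (fun w _ => ?_) hz')
    · simp [hz]
    · split_ifs
      exacts [hterm, le_rfl]

variable [CompleteSpace E]

theorem LocalGenerators.continuous_apply_flow (J : Finset ι) (i : ι) (a : E) :
    Continuous fun s : ℝ => D i (flow (∑ j ∈ J, D j) s a) :=
  (D i).continuous.comp <| continuous_iff_continuousAt.2 fun s =>
    (hasDerivAt_flow_apply (∑ j ∈ J, D j) a s).continuousAt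

/-- Duhamel estimate for removing generators. -/
theorem LocalGenerators.norm_flow_sub_flow_le [DecidableEq ι] (hD : LocalGenerators D supp c Λ) {J K : Finset ι}
    (hJK : J ⊆ K) (a : E) {t b : ℝ} (ht : 0 ≤ t)
    (hb : ∀ s ∈ Set.Icc 0 t, ∑ i ∈ K \ J, ‖D i (flow (∑ j ∈ J, D j) s a)‖ ≤ b) :
    ‖flow (∑ j ∈ K, D j) t a - flow (∑ j ∈ J, D j) t a‖ ≤ b * t := by
  set G := ∑ j ∈ K, D j with hG
  set G' := ∑ j ∈ J, D j with hG'
  -- The restricted flow acts first, so the removed generators are applied to its localized output,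
  -- and the full flow is only used as a contraction.
  set f : ℝ → E := fun s => flow G (t - s) (flow G' s a) with hf
  have hd : ∀ s, HasDerivAt f (flow G (t - s) (G' (flow G' s a) - G (flow G' s a))) s := fun s =>
    hasDerivAt_flow_sub_apply G (hasDerivAt_flow_apply G' a s)
  have key := norm_image_sub_le_of_norm_deriv_le_segment' (f := f) (a := 0) (b := t) (C := b)
    (fun s _ => (hd s).hasDerivWithinAt) (fun s hs => ?_) t (Set.right_mem_Icc.2 ht)
  · rw [norm_sub_rev]
    simpa [hf] using key
  · refine (hD.norm_flow_apply_le _ (sub_nonneg.2 hs.2.le) _).trans ?_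
    have e : G (flow G' s a) - G' (flow G' s a) = ∑ i ∈ K \ J, D i (flow G' s a) := by
      rw [sub_eq_iff_eq_add, hG]
      conv_lhs => rw [← Finset.sum_sdiff hJK]
      simp [hG']
    rw [norm_sub_rev, e]
    exact (norm_sum_le _ _).trans (hb s ⟨hs.1, hs.2.le⟩)

variable [DecidableEq Γ]

/-- Interpolate with the flow of the generators disjoint from `supp i`: it commutes with `D i`, so
in the Duhamel derivative only the generators meeting `supp i` survive. -/
theorem LocalGenerators.norm_apply_flow_le_integral (hD : LocalGenerators D supp c Λ)
    (J : Finset ι) (i : ι) (a : E) {t : ℝ} (ht : 0 ≤ t) :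
    ‖D i (flow (∑ j ∈ J, D j) t a)‖ ≤ ‖D i a‖ + c i * ∫ s in (0 : ℝ)..t,
      ∑ j ∈ J with ¬ Disjoint (supp i) (supp j), ‖D j (flow (∑ j ∈ J, D j) s a)‖ := by
  set G := ∑ j ∈ J, D j with hG
  set G' := ∑ j ∈ J with Disjoint (supp i) (supp j), D j with hG'
  set f : ℝ → E := fun s => flow G' (t - s) (D i (flow G s a)) with hf
  have hcomm : Commute (D i) G' := Commute.sum_right _ _ _ fun j hj =>
    hD.commute i j (Finset.mem_filter.1 hj).2
  have hsplit : G = G' + ∑ j ∈ J with ¬ Disjoint (supp i) (supp j), D j :=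
    (Finset.sum_filter_add_sum_filter_not _ _ _).symm
  have hd : ∀ s, HasDerivAt f (flow G' (t - s) (D i
      (∑ j ∈ J with ¬ Disjoint (supp i) (supp j), D j (flow G s a)))) s := by
    intro s
    have h1 : HasDerivAt (fun s => D i (flow G s a)) (D i (G (flow G s a))) s := by
      simpa [Function.comp_def] using
        ((D i).restrictScalars ℝ).hasFDerivAt.comp_hasDerivAt s (hasDerivAt_flow_apply G a s)
    convert! hasDerivAt_flow_sub_apply G' (t := t) h1 using 2
    have h2 : G' (D i (flow G s a)) = D i (G' (flow G s a)) :=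
      (DFunLike.congr_fun hcomm.eq (flow G s a)).symm
    have h3 : G (flow G s a) = G' (flow G s a) +
        ∑ j ∈ J with ¬ Disjoint (supp i) (supp j), D j (flow G s a) := by
      simpa only [add_apply, sum_apply] using
        DFunLike.congr_fun hsplit (flow G s a)
    rw [h2, h3, map_add, add_sub_cancel_left]
  have hucont : Continuous fun s => ∑ j ∈ J with ¬ Disjoint (supp i) (supp j),
      ‖D j (flow G s a)‖ :=
    continuous_finsetSum _ fun j _ => (LocalGenerators.continuous_apply_flow J j a).norm
  set B : ℝ → ℝ := fun s => ‖D i a‖ + c i * ∫ r in (0 : ℝ)..s,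
    ∑ j ∈ J with ¬ Disjoint (supp i) (supp j), ‖D j (flow G r a)‖ with hB
  have hBd : ∀ s, HasDerivAt B (c i * ∑ j ∈ J with ¬ Disjoint (supp i) (supp j),
      ‖D j (flow G s a)‖) s := fun s =>
    ((hucont.integral_hasStrictDerivAt 0 s).hasDerivAt.const_mul _).const_add _
  have key := image_norm_le_of_norm_deriv_right_le_deriv_boundary' (f := f) (a := 0) (b := t)
    (fun s _ => (hd s).continuousAt.continuousWithinAt) (fun s _ => (hd s).hasDerivWithinAt)
    (B := B) ?_ (fun s _ => (hBd s).continuousAt.continuousWithinAt)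
    (fun s _ => (hBd s).hasDerivWithinAt) (fun s hs => ?_) (Set.right_mem_Icc.2 ht)
  · simpa [hf, hB] using key
  · simpa [hf, hB] using hD.norm_flow_apply_le _ ht (D i a)
  · refine (hD.norm_flow_apply_le _ (sub_nonneg.2 hs.2.le) _).trans ((hD.norm_le _ _).trans ?_)
    exact mul_le_mul_of_nonneg_left (norm_sum_le _ _) (hD.nonneg i)

/-- Lieb–Robinson profile around the site `x` for the kernel `k`. -/
def lrProfile (k : Γ → Γ → ℝ) (m C : ℝ) (x z : Γ) (s : ℝ) : ℝ :=
  (if x = z then 1 else 0) + C⁻¹ * k z x * (Real.exp (m * C * s) - 1)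

theorem lrProfile_nonneg {k : Γ → Γ → ℝ} (hk : ∀ x y, 0 ≤ k x y) {m C : ℝ} (hm : 0 ≤ m)
    (hC : 0 < C) (x z : Γ) {s : ℝ} (hs : 0 ≤ s) : 0 ≤ lrProfile k m C x z s := by
  have h1 : 0 ≤ Real.exp (m * C * s) - 1 := by
    rw [sub_nonneg]; exact Real.one_le_exp (by positivity)
  have h2 := hk z x
  unfold lrProfile
  split_ifs <;> positivity

theorem hasDerivAt_lrProfile (k : Γ → Γ → ℝ) (m : ℝ) {C : ℝ} (hC : 0 < C) (x z : Γ) (s : ℝ) :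
    HasDerivAt (lrProfile k m C x z) (m * k z x * Real.exp (m * C * s)) s := by
  have h1 : HasDerivAt (fun s => Real.exp (m * C * s)) (Real.exp (m * C * s) * (m * C)) s := by
    simpa using ((hasDerivAt_id s).const_mul (m * C)).exp
  convert! ((h1.sub_const 1).const_mul (C⁻¹ * k z x)).const_add (if x = z then (1 : ℝ) else 0)
    using 1
  field_simp

/-- Convolution with `m k` sends the delta term to `m k` and, by the convolution inequality, the
tail to at most `m k (exp - 1)`. The sum is the time derivative of the profile, which makes it a
supersolution. -/
theorem sum_kernel_mul_lrProfile_le {k : Γ → Γ → ℝ} {m C : ℝ} (hm : 0 ≤ m)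
    (hC : 0 < C) (hconv : ∀ x y, ∑ z ∈ Λ, k x z * k z y ≤ C * k x y) {x : Γ} (hx : x ∈ Λ) (y : Γ)
    {s : ℝ} (hs : 0 ≤ s) :
    ∑ z ∈ Λ, m * k y z * lrProfile k m C x z s ≤ m * k y x * Real.exp (m * C * s) := by
  have h1 : 0 ≤ Real.exp (m * C * s) - 1 := by
    rw [sub_nonneg]; exact Real.one_le_exp (by positivity)
  have e : ∑ z ∈ Λ, m * k y z * lrProfile k m C x z s =
      m * k y x + m * C⁻¹ * (Real.exp (m * C * s) - 1) * ∑ z ∈ Λ, k y z * k z x := by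
    simp only [lrProfile, mul_add, Finset.sum_add_distrib, mul_ite, mul_one, mul_zero,
      Finset.sum_ite_eq, hx, if_true, Finset.mul_sum]
    congr 1
    exact Finset.sum_congr rfl fun z _ => by ring
  rw [e]
  have h2 : m * C⁻¹ * (Real.exp (m * C * s) - 1) * ∑ z ∈ Λ, k y z * k z x ≤
      m * C⁻¹ * (Real.exp (m * C * s) - 1) * (C * k y x) :=
    mul_le_mul_of_nonneg_left (hconv y x) (by positivity)
  have h3 : m * C⁻¹ * (Real.exp (m * C * s) - 1) * (C * k y x) =
      m * k y x * (Real.exp (m * C * s) - 1) := by field_simp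
  linarith

/-- Lieb–Robinson bound: the effect of `D i` on the evolution of an element localized in `X`. -/
theorem LocalGenerators.norm_apply_flow_le_lrProfile (hD : LocalGenerators D supp c Λ)
    {I J : Finset ι} (hJI : J ⊆ I) {k : Γ → Γ → ℝ} (hk : ∀ x y, 0 ≤ k x y) {m C : ℝ} (hm : 0 ≤ m)
    (hC : 0 < C) (hconv : ∀ x y, ∑ z ∈ Λ, k x z * k z y ≤ C * k x y)
    (hIk : ∀ y ∈ Λ, ∀ z ∈ Λ, ∑ i ∈ I with y ∈ supp i ∧ z ∈ supp i, c i ≤ m * k y z)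
    {X : Finset Γ} (hX : X ⊆ Λ) {a : E} (ha : ∀ i, Disjoint (supp i) X → D i a = 0)
    {i : ι} (hi : i ∈ I) {s : ℝ} (hs : 0 ≤ s) :
    ‖D i (flow (∑ j ∈ J, D j) s a)‖ ≤
      c i * ‖a‖ * ∑ z ∈ supp i, ∑ x ∈ X, lrProfile k m C x z s := by
  refine le_of_volterra_inequality I (u := fun i s => ‖D i (flow (∑ j ∈ J, D j) s a)‖)
    (w := fun i s => c i * ‖a‖ * ∑ z ∈ supp i, ∑ x ∈ X, lrProfile k m C x z s)
    (w' := fun i s => c i * ‖a‖ * ∑ z ∈ supp i, ∑ x ∈ X, m * k z x * Real.exp (m * C * s))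
    (b := fun i => ‖D i a‖) (c := c) (N := fun i => {j ∈ J | ¬ Disjoint (supp i) (supp j)})
    (fun i => (Finset.filter_subset _ _).trans hJI) hD.nonneg
    (fun i => (LocalGenerators.continuous_apply_flow J i a).norm)
    (fun i s => ?_) (fun i => ?_) (fun i _ s hs => hD.norm_apply_flow_le_integral J i a hs)
    (fun i _ s hs => ?_) (fun i _ => ?_) hi hs
  · exact (HasDerivAt.fun_sum fun z _ => HasDerivAt.fun_sum fun x _ =>
      hasDerivAt_lrProfile k m hC x z s).const_mul _
  · fun_prop
  · rw [mul_assoc (c i)]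
    refine mul_le_mul_of_nonneg_left ?_ (hD.nonneg i)
    set φ : Γ → ℝ := fun z => ∑ x ∈ X, lrProfile k m C x z s with hφ
    have hφ0 : ∀ z, 0 ≤ φ z := fun z => Finset.sum_nonneg fun x _ =>
      lrProfile_nonneg hk hm hC x z hs
    have hterm : ∀ j, 0 ≤ c j * ‖a‖ * ∑ w ∈ supp j, φ w := fun j =>
      mul_nonneg (mul_nonneg (hD.nonneg j) (norm_nonneg a)) (Finset.sum_nonneg fun w _ => hφ0 w)
    -- Count each neighbour `j` at every common point `z` with `supp i`; summing `c j` over the sets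
    -- through `z` and `w` produces the kernel.
    calc ∑ j ∈ J with ¬ Disjoint (supp i) (supp j), c j * ‖a‖ * ∑ w ∈ supp j, φ w
        ≤ ∑ j ∈ J, ∑ z ∈ supp i, if z ∈ supp j then c j * ‖a‖ * ∑ w ∈ supp j, φ w else 0 := by
          rw [Finset.sum_filter]
          refine Finset.sum_le_sum fun j _ => ?_
          rw [ite_not]
          split_ifs with h
          · exact Finset.sum_nonneg fun z _ => by split_ifs; exacts [hterm j, le_rfl]
          · obtain ⟨z, hz, hz'⟩ := Finset.not_disjoint_iff.1 h
            refine le_trans (le_of_eq ?_) (Finset.single_le_sum (f := fun z =>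
              if z ∈ supp j then c j * ‖a‖ * ∑ w ∈ supp j, φ w else 0) (fun w _ => ?_) hz)
            · simp [hz']
            · split_ifs
              exacts [hterm j, le_rfl]
      _ = ∑ z ∈ supp i, ‖a‖ * ∑ w ∈ Λ, (∑ j ∈ J with z ∈ supp j ∧ w ∈ supp j, c j) * φ w := by
          rw [Finset.sum_comm]
          refine Finset.sum_congr rfl fun z _ => ?_
          simp only [Finset.sum_filter, Finset.sum_mul, Finset.mul_sum]
          rw [Finset.sum_comm]
          refine Finset.sum_congr rfl fun j _ => ?_
          by_cases hz : z ∈ supp j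
          · simp only [hz, if_true, true_and, ite_mul, zero_mul, mul_ite, mul_zero]
            rw [← Finset.sum_filter, Finset.filter_mem_eq_inter,
              Finset.inter_eq_right.2 (hD.supp_subset j)]
            exact Finset.sum_congr rfl fun w _ => by ring
          · simp [hz]
      _ ≤ ∑ z ∈ supp i, ‖a‖ * ∑ w ∈ Λ, m * k z w * φ w := by
          refine Finset.sum_le_sum fun z hz => mul_le_mul_of_nonneg_left
            (Finset.sum_le_sum fun w hw => mul_le_mul_of_nonneg_right ?_ (hφ0 w)) (norm_nonneg a)
          refine le_trans ?_ (hIk z (hD.supp_subset i hz) w hw)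
          exact Finset.sum_le_sum_of_subset_of_nonneg (Finset.filter_subset_filter _ hJI)
            fun j _ _ => hD.nonneg j
      _ ≤ ∑ z ∈ supp i, ‖a‖ * ∑ x ∈ X, m * k z x * Real.exp (m * C * s) := by
          refine Finset.sum_le_sum fun z _ => mul_le_mul_of_nonneg_left ?_ (norm_nonneg a)
          simp only [hφ, Finset.mul_sum]
          rw [Finset.sum_comm]
          exact Finset.sum_le_sum fun x hx => sum_kernel_mul_lrProfile_le hm hC hconv (hX hx) z hs
      _ = ‖a‖ * ∑ z ∈ supp i, ∑ x ∈ X, m * k z x * Real.exp (m * C * s) := by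
          rw [Finset.mul_sum]
  -- At time zero a support meeting `X` is paid for by the delta term at a common point.
  · by_cases hd : Disjoint (supp i) X
    · simp only [ha i hd, norm_zero]
      exact mul_nonneg (mul_nonneg (hD.nonneg i) (norm_nonneg a)) (Finset.sum_nonneg fun z _ =>
        Finset.sum_nonneg fun x _ => lrProfile_nonneg hk hm hC x z le_rfl)
    · obtain ⟨z, hz, hz'⟩ := Finset.not_disjoint_iff.1 hd
      refine (hD.norm_le i a).trans (le_mul_of_one_le_right
        (mul_nonneg (hD.nonneg i) (norm_nonneg a)) ?_)
      have h0 : ∀ w x, 0 ≤ lrProfile k m C x w 0 := fun w x =>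
        lrProfile_nonneg hk hm hC x w le_rfl
      calc (1 : ℝ) = lrProfile k m C z z 0 := by simp [lrProfile]
        _ ≤ ∑ x ∈ X, lrProfile k m C x z 0 :=
          Finset.single_le_sum (f := fun x => lrProfile k m C x z 0) (fun x _ => h0 z x) hz'
        _ ≤ _ := Finset.single_le_sum (f := fun z => ∑ x ∈ X, lrProfile k m C x z 0)
          (fun w _ => Finset.sum_nonneg fun x _ => h0 w x) hz

/-- Total effect of local generators reaching far away from the localization region `X`. -/
theorem LocalGenerators.sum_norm_apply_flow_le (hD : LocalGenerators D supp c Λ)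
    {I J K : Finset ι} (hJI : J ⊆ I) (hKI : K ⊆ I) {k : Γ → Γ → ℝ} (hk : ∀ x y, 0 ≤ k x y)
    {m C : ℝ} (hm : 0 ≤ m) (hC : 0 < C) (hconv : ∀ x y, ∑ z ∈ Λ, k x z * k z y ≤ C * k x y)
    (hIk : ∀ y ∈ Λ, ∀ z ∈ Λ, ∑ i ∈ I with y ∈ supp i ∧ z ∈ supp i, c i ≤ m * k y z)
    {X : Finset Γ} (hX : X ⊆ Λ) {a : E} (ha : ∀ i, Disjoint (supp i) X → D i a = 0)
    {far : Γ → Finset Γ} (hfar : ∀ x ∈ X, ∀ i ∈ K, ∃ y ∈ supp i, y ∈ far x)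
    {s : ℝ} (hs : 0 ≤ s) :
    ∑ i ∈ K, ‖D i (flow (∑ j ∈ J, D j) s a)‖ ≤
      ‖a‖ * m * Real.exp (m * C * s) * ∑ x ∈ X, ∑ y ∈ Λ with y ∈ far x, k y x := by
  have h0 : ∀ x z, 0 ≤ lrProfile k m C x z s := fun x z => lrProfile_nonneg hk hm hC x z hs
  calc ∑ i ∈ K, ‖D i (flow (∑ j ∈ J, D j) s a)‖
      ≤ ∑ i ∈ K, c i * ‖a‖ * ∑ z ∈ supp i, ∑ x ∈ X, lrProfile k m C x z s :=
        Finset.sum_le_sum fun i hi =>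
          hD.norm_apply_flow_le_lrProfile hJI hk hm hC hconv hIk hX ha (hKI hi) hs
    _ = ‖a‖ * ∑ x ∈ X, ∑ i ∈ K, c i * ∑ z ∈ supp i, lrProfile k m C x z s := by
        rw [Finset.sum_comm, Finset.mul_sum]
        refine Finset.sum_congr rfl fun i _ => ?_
        rw [Finset.sum_comm, ← Finset.mul_sum]
        ring
    _ ≤ ‖a‖ * ∑ x ∈ X, ∑ y ∈ Λ with y ∈ far x, m * k y x * Real.exp (m * C * s) := by
        refine mul_le_mul_of_nonneg_left (Finset.sum_le_sum fun x hx => ?_) (norm_nonneg a)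
        have hterm : ∀ i, 0 ≤ c i * ∑ z ∈ supp i, lrProfile k m C x z s := fun i =>
          mul_nonneg (hD.nonneg i) (Finset.sum_nonneg fun z _ => h0 x z)
        -- Each `i` has a point `y` in the far region of `x`. Summing over pairs `y`, `z` in its
        -- support yields one more convolution of kernel and profile.
        calc ∑ i ∈ K, c i * ∑ z ∈ supp i, lrProfile k m C x z s
            ≤ ∑ i ∈ K, ∑ y ∈ Λ with y ∈ far x,
                if y ∈ supp i then c i * ∑ z ∈ supp i, lrProfile k m C x z s else 0 := by
              refine Finset.sum_le_sum fun i hi => ?_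
              obtain ⟨y, hy, hy'⟩ := hfar x hx i hi
              refine le_trans (le_of_eq ?_) (Finset.single_le_sum (f := fun y =>
                if y ∈ supp i then c i * ∑ z ∈ supp i, lrProfile k m C x z s else 0)
                (fun w _ => ?_) (Finset.mem_filter.2 ⟨hD.supp_subset i hy, hy'⟩))
              · simp [hy]
              · split_ifs
                exacts [hterm i, le_rfl]
          _ = ∑ y ∈ Λ with y ∈ far x, ∑ z ∈ Λ,
                (∑ i ∈ K with y ∈ supp i ∧ z ∈ supp i, c i) * lrProfile k m C x z s := by
              rw [Finset.sum_comm]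
              refine Finset.sum_congr rfl fun y _ => ?_
              simp only [Finset.sum_filter, Finset.sum_mul, Finset.mul_sum]
              rw [Finset.sum_comm]
              refine Finset.sum_congr rfl fun i _ => ?_
              by_cases hy : y ∈ supp i
              · simp only [hy, if_true, true_and, ite_mul, zero_mul]
                rw [← Finset.sum_filter, Finset.filter_mem_eq_inter,
                  Finset.inter_eq_right.2 (hD.supp_subset i)]
              · simp [hy]
          _ ≤ ∑ y ∈ Λ with y ∈ far x, ∑ z ∈ Λ, m * k y z * lrProfile k m C x z s := by
              refine Finset.sum_le_sum fun y hy => Finset.sum_le_sum fun z hz =>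
                mul_le_mul_of_nonneg_right ?_ (h0 x z)
              refine le_trans ?_ (hIk y (Finset.mem_filter.1 hy).1 z hz)
              exact Finset.sum_le_sum_of_subset_of_nonneg (Finset.filter_subset_filter _ hKI)
                fun j _ _ => hD.nonneg j
          _ ≤ _ := Finset.sum_le_sum fun y _ =>
              sum_kernel_mul_lrProfile_le hm hC hconv (hX hx) y hs
    _ = _ := by
        simp only [Finset.mul_sum]
        refine Finset.sum_congr rfl fun x _ => Finset.sum_congr rfl fun y _ => by ring

end Locality

/-! ### Power-law decay on regular spaces -/

section Decay

variable {Γ : Type*} [MetricSpace Γ] {κ ν : ℝ}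

theorem powerLaw_pos (α : ℝ) {r : ℝ} (hr : 0 ≤ r) : 0 < powerLaw α r := by
  unfold powerLaw; positivity

theorem powerLaw_eq_rpow_neg (α : ℝ) {r : ℝ} (hr : 0 ≤ r) : powerLaw α r = (1 + r) ^ (-α) := by
  rw [powerLaw, Real.rpow_neg (by positivity), one_div]

theorem summable_zetaConst {ε : ℝ} (hε : 0 < ε) :
    Summable fun n : ℕ => 1 / (1 + (n : ℝ)) ^ (1 + ε) := by
  have h := (summable_nat_add_iff 1).2 (Real.summable_one_div_nat_rpow.2 (by linarith : 1 < 1 + ε))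
  simpa [add_comm] using h

theorem zetaConst_nonneg (ε : ℝ) : 0 ≤ zetaConst ε :=
  tsum_nonneg fun n => by positivity

theorem IsRegularSpace.card_le (hΓ : IsRegularSpace Γ κ ν) (s : Finset Γ) (x : Γ) (n : ℕ)
    (hs : ∀ y ∈ s, dist x y ≤ (n : ℝ) + 1) : (s.card : ℝ) ≤ κ * ((n : ℝ) + 1) ^ ν := by
  refine le_trans ?_ (hΓ.ball_card x n)
  rw [← Set.ncard_coe_finset]
  have h : (s : Set Γ).ncard ≤ (Metric.closedBall x ((n : ℝ) + 1)).ncard :=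
    Set.ncard_le_ncard (fun y hy => by
      rw [Metric.mem_closedBall, dist_comm]; exact hs y hy) (hΓ.ball_finite x n)
  exact Nat.cast_le.2 h

theorem IsRegularSpace.card_le_of_dist_lt (hΓ : IsRegularSpace Γ κ ν) (s : Finset Γ) (x : Γ)
    {r : ℝ} (hr : 0 ≤ r) (hs : ∀ y ∈ s, dist x y < r) : (s.card : ℝ) ≤ κ * (1 + r) ^ ν := by
  refine (hΓ.card_le s x ⌊r⌋₊ fun y hy => ((hs y hy).trans (Nat.lt_floor_add_one r)).le).trans ?_
  have h1 := Nat.floor_le hr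
  have h2 := hΓ.nu_pos.le
  have h3 := hΓ.kappa_pos.le
  rw [add_comm 1 r]
  gcongr

/-- Sort the points into shells by integer part `n` of the distance: the ball bound `κ (n + 1) ^ ν`
cancels `ν` in the exponent and leaves the series of `zetaConst`. -/
theorem IsRegularSpace.sum_rpow_neg_le (hΓ : IsRegularSpace Γ κ ν) {ε : ℝ} (hε : 0 < ε)
    (s : Finset Γ) (x : Γ) :
    ∑ y ∈ s, (1 + dist x y) ^ (-(ν + 1 + ε)) ≤ κ * zetaConst ε := by
  classical
  have hκ := hΓ.kappa_pos
  have hν := hΓ.nu_pos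
  let T : Finset ℕ := s.image fun y => ⌊dist x y⌋₊
  rw [← Finset.sum_fiberwise_of_maps_to (t := T) (g := fun y => ⌊dist x y⌋₊)
    (fun y hy => Finset.mem_image_of_mem _ hy)]
  calc ∑ n ∈ T, ∑ y ∈ s with ⌊dist x y⌋₊ = n, (1 + dist x y) ^ (-(ν + 1 + ε))
      ≤ ∑ n ∈ T, κ * (1 / (1 + (n : ℝ)) ^ (1 + ε)) := by
        refine Finset.sum_le_sum fun n _ => ?_
        have hn : (0 : ℝ) < 1 + n := by positivity
        calc ∑ y ∈ s with ⌊dist x y⌋₊ = n, (1 + dist x y) ^ (-(ν + 1 + ε))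
            ≤ ∑ y ∈ s with ⌊dist x y⌋₊ = n, (1 + (n : ℝ)) ^ (-(ν + 1 + ε)) := by
              refine Finset.sum_le_sum fun y hy => ?_
              refine Real.rpow_le_rpow_of_nonpos hn ?_ (by linarith)
              have := Nat.floor_le (dist_nonneg (x := x) (y := y))
              rw [(Finset.mem_filter.1 hy).2] at this
              linarith
          _ = (Finset.card {y ∈ s | ⌊dist x y⌋₊ = n} : ℝ) * (1 + (n : ℝ)) ^ (-(ν + 1 + ε)) := by
              rw [Finset.sum_const, nsmul_eq_mul]
          _ ≤ κ * ((n : ℝ) + 1) ^ ν * (1 + (n : ℝ)) ^ (-(ν + 1 + ε)) := by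
              refine mul_le_mul_of_nonneg_right (hΓ.card_le _ x n fun y hy => ?_) (by positivity)
              have := Nat.lt_floor_add_one (dist x y)
              rw [(Finset.mem_filter.1 hy).2] at this
              exact this.le
          _ = κ * (1 / (1 + (n : ℝ)) ^ (1 + ε)) := by
              rw [mul_assoc, add_comm (n : ℝ) 1, ← Real.rpow_add hn, one_div,
                ← Real.rpow_neg hn.le]
              congr 2
              ring
    _ = κ * ∑ n ∈ T, 1 / (1 + (n : ℝ)) ^ (1 + ε) := by rw [Finset.mul_sum]
    _ ≤ κ * zetaConst ε := by
        refine mul_le_mul_of_nonneg_left ?_ hκ.le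
        exact (summable_zetaConst hε).sum_le_tsum _ fun n _ => by positivity

/-- Split `α` into `ν + 1 + ε`, which pays for summability, and `reducedExponent`, which remains as
decay in `ρ`. -/
theorem IsRegularSpace.sum_powerLaw_le (hΓ : IsRegularSpace Γ κ ν) {α ε : ℝ} (hε : 0 < ε)
    (hα : 0 ≤ reducedExponent α ν ε) (s : Finset Γ) (x : Γ) {ρ : ℝ} (hρ : 0 ≤ ρ)
    (hs : ∀ y ∈ s, ρ ≤ dist x y) :
    ∑ y ∈ s, powerLaw α (dist x y) ≤ κ * zetaConst ε * (1 + ρ) ^ (-reducedExponent α ν ε) := by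
  refine le_trans ?_ (mul_le_mul_of_nonneg_right (hΓ.sum_rpow_neg_le hε s x) (by positivity))
  rw [Finset.sum_mul]
  refine Finset.sum_le_sum fun y hy => ?_
  have hd : 0 < 1 + dist x y := by positivity
  rw [powerLaw_eq_rpow_neg α dist_nonneg]
  calc (1 + dist x y) ^ (-α)
      = (1 + dist x y) ^ (-(ν + 1 + ε)) * (1 + dist x y) ^ (-reducedExponent α ν ε) := by
        rw [← Real.rpow_add hd, reducedExponent]
        congr 1
        ring
    _ ≤ _ := by
        refine mul_le_mul_of_nonneg_left ?_ (by positivity)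
        exact Real.rpow_le_rpow_of_nonpos (by positivity) (by linarith [hs y hy]) (by linarith)

theorem IsRegularSpace.decaySum_le (hΓ : IsRegularSpace Γ κ ν) {α ε : ℝ} (hε : 0 < ε)
    (hα : 0 ≤ reducedExponent α ν ε) (x : Γ) :
    ∑' y : Γ, ENNReal.ofReal (powerLaw α (dist x y)) ≤ ENNReal.ofReal (κ * zetaConst ε) := by
  refine ENNReal.summable.tsum_le_of_sum_le fun s => ?_
  rw [← ENNReal.ofReal_sum_of_nonneg fun y _ => (powerLaw_pos α dist_nonneg).le]
  refine ENNReal.ofReal_le_ofReal ?_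
  simpa using hΓ.sum_powerLaw_le hε hα s x le_rfl fun y _ => dist_nonneg

/-- By the triangle inequality the larger of the two distances is at least half of `dist x y`, so
its factor is at most `2 ^ α F(d(x, y))`. -/
theorem powerLaw_mul_powerLaw_le {α : ℝ} (hα : 0 ≤ α) (x y z : Γ) :
    powerLaw α (dist x z) * powerLaw α (dist z y) ≤
      2 ^ α * powerLaw α (dist x y) * (powerLaw α (dist x z) + powerLaw α (dist y z)) := by
  have hF := fun u v : Γ => (powerLaw_pos α (dist_nonneg (x := u) (y := v))).le
  have hhalf : ∀ u v : Γ, dist x y ≤ 2 * dist u v + 1 →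
      powerLaw α (dist u v) ≤ 2 ^ α * powerLaw α (dist x y) := by
    intro u v h
    rw [powerLaw_eq_rpow_neg α dist_nonneg, powerLaw_eq_rpow_neg α dist_nonneg,
      Real.rpow_neg (by positivity), Real.rpow_neg (by positivity), ← div_eq_mul_inv,
      le_div_iff₀ (by positivity), inv_mul_le_iff₀ (by positivity),
      ← Real.mul_rpow (by positivity) (by positivity)]
    exact Real.rpow_le_rpow (by positivity) (by linarith) hα
  have ht := dist_triangle x z y
  rw [dist_comm y z, mul_add]
  have h0 : 0 ≤ 2 ^ α * powerLaw α (dist x y) := mul_nonneg (by positivity) (hF x y)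
  rcases le_total (dist x z) (dist z y) with h | h
  · have h1 := hhalf z y (by linarith)
    have h2 := mul_le_mul_of_nonneg_left h1 (hF x z)
    have h3 := mul_nonneg h0 (hF z y)
    linarith
  · have h1 := hhalf x z (by linarith)
    have h2 := mul_le_mul_of_nonneg_right h1 (hF z y)
    have h3 := mul_nonneg h0 (hF x z)
    linarith

theorem IsRegularSpace.convConst_lt_top (hΓ : IsRegularSpace Γ κ ν) {α ε : ℝ} (hε : 0 < ε)
    (hα : 0 ≤ reducedExponent α ν ε) : convConst Γ (powerLaw α) < ⊤ := by
  have hα0 : 0 ≤ α := by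
    have := hΓ.nu_pos
    unfold reducedExponent at hα
    linarith
  refine lt_of_le_of_lt (sInf_le (a := ENNReal.ofReal (2 ^ α) *
    (ENNReal.ofReal (κ * zetaConst ε) + ENNReal.ofReal (κ * zetaConst ε))) fun x y => ?_)
    (ENNReal.mul_lt_top ENNReal.ofReal_lt_top
      (ENNReal.add_lt_top.2 ⟨ENNReal.ofReal_lt_top, ENNReal.ofReal_lt_top⟩))
  have hF := fun u v : Γ => (powerLaw_pos α (dist_nonneg (x := u) (y := v))).le
  calc ∑' z, ENNReal.ofReal (powerLaw α (dist x z)) * ENNReal.ofReal (powerLaw α (dist z y))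
      ≤ ∑' z, ENNReal.ofReal (2 ^ α) * ENNReal.ofReal (powerLaw α (dist x y)) *
          (ENNReal.ofReal (powerLaw α (dist x z)) + ENNReal.ofReal (powerLaw α (dist y z))) := by
        refine ENNReal.tsum_le_tsum fun z => ?_
        rw [← ENNReal.ofReal_mul (hF _ _), ← ENNReal.ofReal_mul (by positivity),
          ← ENNReal.ofReal_add (hF _ _) (hF _ _),
          ← ENNReal.ofReal_mul (mul_nonneg (by positivity) (hF _ _))]
        exact ENNReal.ofReal_le_ofReal (powerLaw_mul_powerLaw_le hα0 x y z)
    _ = ENNReal.ofReal (2 ^ α) * ENNReal.ofReal (powerLaw α (dist x y)) *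
          (∑' z, ENNReal.ofReal (powerLaw α (dist x z)) +
            ∑' z, ENNReal.ofReal (powerLaw α (dist y z))) := by
        rw [ENNReal.tsum_mul_left, ENNReal.tsum_add]
    _ ≤ ENNReal.ofReal (2 ^ α) * ENNReal.ofReal (powerLaw α (dist x y)) *
          (ENNReal.ofReal (κ * zetaConst ε) + ENNReal.ofReal (κ * zetaConst ε)) := by
        gcongr <;> exact hΓ.decaySum_le hε hα _
    _ = _ := by ring

theorem one_le_convConst [Nonempty Γ] (α : ℝ) : 1 ≤ convConst Γ (powerLaw α) := by
  refine le_sInf fun C hC => ?_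
  let x : Γ := Classical.arbitrary Γ
  have h := hC x x
  have h1 : ENNReal.ofReal (powerLaw α (dist x x)) = 1 := by simp [powerLaw]
  rw [h1, mul_one] at h
  refine le_trans ?_ h
  refine le_trans (le_of_eq ?_) (ENNReal.le_tsum x)
  rw [h1, mul_one]

/-- The infimum is attained: `F` is positive and finite, so the constraint can be divided by it. -/
theorem tsum_mul_le_convConst (α : ℝ) (x y : Γ) :
    ∑' z : Γ, ENNReal.ofReal (powerLaw α (dist x z)) * ENNReal.ofReal (powerLaw α (dist z y)) ≤
      convConst Γ (powerLaw α) * ENNReal.ofReal (powerLaw α (dist x y)) := by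
  have h0 : ENNReal.ofReal (powerLaw α (dist x y)) ≠ 0 :=
    (ENNReal.ofReal_pos.2 (powerLaw_pos α dist_nonneg)).ne'
  rw [← ENNReal.div_le_iff h0 ENNReal.ofReal_ne_top]
  refine le_sInf fun C hC => ?_
  rw [ENNReal.div_le_iff h0 ENNReal.ofReal_ne_top]
  exact hC x y

theorem sum_powerLaw_mul_le {α : ℝ} (hC : convConst Γ (powerLaw α) < ⊤) (s : Finset Γ) (x y : Γ) :
    ∑ z ∈ s, powerLaw α (dist x z) * powerLaw α (dist z y) ≤
      (convConst Γ (powerLaw α)).toReal * powerLaw α (dist x y) := by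
  have hF := fun u v : Γ => (powerLaw_pos α (dist_nonneg (x := u) (y := v))).le
  rw [← ENNReal.ofReal_le_ofReal_iff (mul_nonneg ENNReal.toReal_nonneg (hF x y)),
    ENNReal.ofReal_mul ENNReal.toReal_nonneg, ENNReal.ofReal_toReal hC.ne,
    ENNReal.ofReal_sum_of_nonneg fun z _ => mul_nonneg (hF x z) (hF z y)]
  refine le_trans ?_ (tsum_mul_le_convConst α x y)
  refine le_trans (le_of_eq ?_) (ENNReal.sum_le_tsum s)
  exact Finset.sum_congr rfl fun z _ => ENNReal.ofReal_mul (hF x z)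

variable [DecidableEq Γ] {q : Γ → ℕ}

theorem tsum_cbNorm_le (α : ℝ) (L : DissipativeInteraction q) (x y : Γ) :
    ∑' Z : {Z : Finset Γ // x ∈ Z ∧ y ∈ Z}, cbNorm (L.map Z.1) ≤
      interactionNorm (powerLaw α) L * ENNReal.ofReal (powerLaw α (dist x y)) := by
  have h0 : ENNReal.ofReal (powerLaw α (dist x y)) ≠ 0 :=
    (ENNReal.ofReal_pos.2 (powerLaw_pos α dist_nonneg)).ne'
  rw [← ENNReal.div_le_iff h0 ENNReal.ofReal_ne_top]
  refine le_sInf fun C hC => ?_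
  rw [ENNReal.div_le_iff h0 ENNReal.ofReal_ne_top]
  exact hC x y

theorem cbNorm_lt_top {α : ℝ} {L : DissipativeInteraction q}
    (hL : interactionNorm (powerLaw α) L < ⊤) {Z : Finset Γ} (hZ : Z.Nonempty) :
    cbNorm (L.map Z) < ⊤ := by
  obtain ⟨x, hx⟩ := hZ
  refine lt_of_le_of_lt ?_ (ENNReal.mul_lt_top hL (ENNReal.ofReal_lt_top (r := powerLaw α (dist x x))))
  exact (ENNReal.le_tsum (f := fun Z : {Z : Finset Γ // x ∈ Z ∧ x ∈ Z} => cbNorm (L.map Z.1))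
    ⟨Z, hx, hx⟩).trans (tsum_cbNorm_le α L x x)

theorem sum_cbNorm_le {α : ℝ} {L : DissipativeInteraction q}
    (hL : interactionNorm (powerLaw α) L < ⊤) {ι : Type*} (I : Finset ι) {supp : ι → Finset Γ}
    (hinj : Function.Injective supp) (x y : Γ) (hI : ∀ i ∈ I, x ∈ supp i ∧ y ∈ supp i) :
    ∑ i ∈ I, (cbNorm (L.map (supp i))).toReal ≤
      (interactionNorm (powerLaw α) L).toReal * powerLaw α (dist x y) := by
  have hF := (powerLaw_pos α (dist_nonneg (x := x) (y := y))).le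
  rw [← ENNReal.ofReal_le_ofReal_iff (mul_nonneg ENNReal.toReal_nonneg hF),
    ENNReal.ofReal_mul ENNReal.toReal_nonneg, ENNReal.ofReal_toReal hL.ne,
    ENNReal.ofReal_sum_of_nonneg fun i _ => ENNReal.toReal_nonneg]
  refine le_trans ?_ (tsum_cbNorm_le α L x y)
  let f : I → {Z : Finset Γ // x ∈ Z ∧ y ∈ Z} := fun i => ⟨supp i, hI i i.2⟩
  have hf : Function.Injective f := fun i j hij =>
    Subtype.ext (hinj (congrArg Subtype.val hij))
  calc ∑ i ∈ I, ENNReal.ofReal (cbNorm (L.map (supp i))).toReal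
      = ∑ i : I, cbNorm (L.map (f i).1) := by
        rw [← Finset.sum_coe_sort]
        refine Finset.sum_congr rfl fun i _ => ?_
        exact ENNReal.ofReal_toReal (cbNorm_lt_top hL ⟨x, (hI i i.2).1⟩).ne
    _ = ∑' i : I, cbNorm (L.map (f i).1) := (tsum_fintype _).symm
    _ ≤ _ := ENNReal.tsum_comp_le_tsum_of_injective hf
        (fun Z : {Z : Finset Γ // x ∈ Z ∧ y ∈ Z} => cbNorm (L.map Z.1))

end Decay

/-! ### Dynamics of localized observables -/

section LocalDynamics

variable {Γ : Type*} [DecidableEq Γ] {q : Γ → ℕ}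

/-- The generator attached to `Z ⊆ Λ`, as a bounded operator on the observables in `Λ`. -/
def localMap (L : DissipativeInteraction q) (Λ : Finset Γ) (Z : {Z // Z ∈ Λ.powerset}) :
    Obs q Λ →L[ℂ] Obs q Λ :=
  LinearMap.toContinuousLinearMap (extend (Finset.mem_powerset.1 Z.2) (L.map Z.1))

theorem localMap_apply (L : DissipativeInteraction q) (Λ : Finset Γ) (Z : {Z // Z ∈ Λ.powerset})
    (M : Obs q Λ) : localMap L Λ Z M = extend (Finset.mem_powerset.1 Z.2) (L.map Z.1) M := rfl

theorem dynamics_apply (L : DissipativeInteraction q) (Λ : Finset Γ) (t : ℝ) (M : Obs q Λ) :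
    dynamics L Λ t M = flow (∑ Z, localMap L Λ Z) t M := by
  have h : LinearMap.toContinuousLinearMap (generator L Λ) = ∑ Z, localMap L Λ Z := by
    rw [generator, map_sum]
    rfl
  rw [dynamics, expSemigroup, h]
  rfl

/-- `M` commutes with all observables whose support is disjoint from `X`. -/
def IsLocalizedIn {Λ : Finset Γ} (X : Finset Γ) (M : Obs q Λ) : Prop :=
  ∀ (Z : Finset Γ) (h : Z ⊆ Λ), Disjoint Z X → ∀ B : Obs q Z, Commute (embed h B) M

variable {L : DissipativeInteraction q} {Λ X Y : Finset Γ} {M N : Obs q Λ}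

theorem isLocalizedIn_embed (h : X ⊆ Λ) (A : Obs q X) : IsLocalizedIn X (embed h A) :=
  fun _ hZ hd B => commute_embed hZ h hd B A

theorem IsLocalizedIn.mono (hM : IsLocalizedIn X M) (h : X ⊆ Y) : IsLocalizedIn Y M :=
  fun Z hZ hd => hM Z hZ (hd.mono_right h)

theorem IsLocalizedIn.mul (hM : IsLocalizedIn X M) (hN : IsLocalizedIn X N) :
    IsLocalizedIn X (M * N) :=
  fun Z hZ hd B => (hM Z hZ hd B).mul_right (hN Z hZ hd B)

theorem IsLocalizedIn.localMap_eq_zero (hM : IsLocalizedIn X M) (Z : {Z // Z ∈ Λ.powerset})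
    (hd : Disjoint Z.1 X) : localMap L Λ Z M = 0 :=
  extend_eq_zero_of_commute _ (L.lindblad Z.1) (hM Z.1 _ hd)

theorem IsLocalizedIn.localMap_apply (hM : IsLocalizedIn X M) (Z : {Z // Z ∈ Λ.powerset})
    (hZ : Z.1 ⊆ X) : IsLocalizedIn X (localMap L Λ Z M) := fun W hW hd B =>
  commute_extend_apply _ (L.lindblad Z.1)
    (fun C => commute_embed _ hW (hd.symm.mono_left hZ) C B) (hM W hW hd B)

/-- Observables localized in `X`, as a subspace. -/
def localizedSubmodule (q : Γ → ℕ) (Λ X : Finset Γ) : Submodule ℂ (Obs q Λ) where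
  carrier := {M | IsLocalizedIn X M}
  add_mem' hM hN := fun Z hZ hd B => (hM Z hZ hd B).add_right (hN Z hZ hd B)
  zero_mem' := fun _ _ _ _ => Commute.zero_right _
  smul_mem' c _ hM := fun Z hZ hd B => (hM Z hZ hd B).smul_right c

/-- Every partial sum of the exponential series stays in `V`, which is closed in finite dimension.
-/
theorem flow_mem_of_mapsTo {E : Type*} [NormedAddCommGroup E] [NormedSpace ℂ E]
    [FiniteDimensional ℂ E] (G : E →L[ℂ] E) (V : Submodule ℂ E) (hG : ∀ a ∈ V, G a ∈ V) (t : ℝ)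
    {a : E} (ha : a ∈ V) : flow G t a ∈ V := by
  have : CompleteSpace E := FiniteDimensional.complete ℂ E
  have h1 := NormedSpace.exp_series_hasSum_exp' (𝕂 := ℂ) ((t : ℂ) • G)
  have h2 := (ContinuousLinearMap.apply ℂ E a).hasSum h1
  have hpow : ∀ n : ℕ, (((t : ℂ) • G) ^ n) a ∈ V := by
    intro n
    induction n with
    | zero => simpa using ha
    | succ n ih =>
      rw [pow_succ']
      exact V.smul_mem _ (hG _ ih)
  refine (Submodule.closed_of_finiteDimensional V).mem_of_tendsto h2
    (Filter.Eventually.of_forall fun s => V.sum_mem fun n _ => ?_)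
  exact V.smul_mem _ (hpow n)

variable {J : Finset {Z // Z ∈ Λ.powerset}}

theorem IsLocalizedIn.flow_apply (hM : IsLocalizedIn X M)
    (hJ : ∀ Z ∈ J, Z.1 ⊆ X ∨ Disjoint Z.1 X) (t : ℝ) :
    IsLocalizedIn X (flow (∑ Z ∈ J, localMap L Λ Z) t M) := by
  refine flow_mem_of_mapsTo _ (localizedSubmodule q Λ X) (fun a ha => ?_) t hM
  rw [sum_apply]
  refine Submodule.sum_mem _ fun Z hZ => ?_
  rcases hJ Z hZ with h | h
  · exact IsLocalizedIn.localMap_apply ha Z h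
  · rw [IsLocalizedIn.localMap_eq_zero ha Z h]
    exact Submodule.zero_mem _

/-- Dynamics that do not couple the disjoint regions `X` and `Y` factorize. -/
theorem flow_mul (hXY : Disjoint X Y) (hJ : ∀ Z ∈ J, Z.1 ⊆ X ∨ Z.1 ⊆ Y)
    (hM : IsLocalizedIn X M) (hN : IsLocalizedIn Y N) (t : ℝ) :
    flow (∑ Z ∈ J, localMap L Λ Z) t (M * N) =
      flow (∑ Z ∈ J, localMap L Λ Z) t M * flow (∑ Z ∈ J, localMap L Λ Z) t N := by
  have hJX : ∀ Z ∈ J, Z.1 ⊆ X ∨ Disjoint Z.1 X := fun Z hZ =>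
    (hJ Z hZ).imp_right fun h => hXY.symm.mono_left h
  have hJY : ∀ Z ∈ J, Z.1 ⊆ Y ∨ Disjoint Z.1 Y := fun Z hZ =>
    (hJ Z hZ).symm.imp_right fun h => hXY.mono_left h
  set G := ∑ Z ∈ J, localMap L Λ Z with hG
  -- Each set lies in one of the regions: its generator annihilates the factor of the other region
  -- and is linear over it.
  have leibniz : ∀ P Q : Obs q Λ, IsLocalizedIn X P → IsLocalizedIn Y Q →
      G (P * Q) = G P * Q + P * G Q := by
    intro P Q hP hQ
    rw [hG, sum_apply, sum_apply, sum_apply, Finset.sum_mul, Finset.mul_sum,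
      ← Finset.sum_add_distrib]
    refine Finset.sum_congr rfl fun Z hZ => ?_
    rcases hJ Z hZ with h | h
    · have hd : Disjoint Z.1 Y := hXY.mono_left h
      rw [hQ.localMap_eq_zero Z hd, mul_zero, add_zero]
      exact extend_mul_right _ (L.lindblad Z.1) (hQ Z.1 _ hd) P
    · have hd : Disjoint Z.1 X := hXY.symm.mono_left h
      rw [hP.localMap_eq_zero Z hd, zero_mul, zero_add]
      exact extend_mul_left _ (L.lindblad Z.1) (hP Z.1 _ hd) Q
  -- The Leibniz rule makes this interpolation constant; its values at `0` and `t` are the two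
  -- sides.
  have hd : ∀ s, HasDerivAt (fun s => flow G (t - s) (flow G s M * flow G s N)) 0 s := by
    intro s
    have h := hasDerivAt_flow_sub_apply G (t := t)
      ((hasDerivAt_flow_apply G M s).mul (hasDerivAt_flow_apply G N s))
    have e := leibniz (flow G s M) (flow G s N) (hM.flow_apply hJX s) (hN.flow_apply hJY s)
    convert! h using 1
    simp [e]
  have hc := is_const_of_deriv_eq_zero (fun s => (hd s).differentiableAt)
    (fun s => (hd s).deriv) 0 t
  simpa using hc

/-- Commuting with the diagonal projection onto the value `σ x` at the site `x` rules out entries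
that change this value. -/
theorem IsLocalizedIn.apply_eq_zero (hM : IsLocalizedIn X M) {σ τ : Config q Λ} {x : Λ}
    (hx : (x : Γ) ∉ X) (hστ : σ x ≠ τ x) : M σ τ = 0 := by
  have hs : ({(x : Γ)} : Finset Γ) ⊆ Λ := Finset.singleton_subset_iff.2 x.2
  let d : Config q {(x : Γ)} → ℂ := fun c => if c = restrictConfig hs σ then 1 else 0
  have h := congrFun (congrFun (hM _ hs (Finset.disjoint_singleton_left.2 hx)
    (Matrix.diagonal d)).eq σ) τ
  have hτ : d (restrictConfig hs τ) = 0 := by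
    refine if_neg fun hc => hστ ?_
    exact (congrFun hc ⟨x, Finset.mem_singleton_self _⟩).symm
  rw [embed_mul_apply, mul_embed_apply, Finset.sum_eq_single (restrictConfig hs σ),
    Finset.sum_eq_single (restrictConfig hs τ)] at h
  · rw [Matrix.diagonal_apply_eq, Matrix.diagonal_apply_eq, hτ, mul_zero,
      overrideConfig_restrictConfig hs fun _ _ => rfl] at h
    simpa [d] using h
  · intro b _ hb
    rw [Matrix.diagonal_apply_ne _ hb, mul_zero]
  · simp
  · intro b _ hb
    rw [Matrix.diagonal_apply_ne _ hb.symm, zero_mul]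
  · simp

/-- An intermediate configuration differing from `σ` at a site would need both factors to change
that site, and one of them cannot. Diagonal entries are thus product states. -/
theorem IsLocalizedIn.mul_apply_self (hXY : Disjoint X Y) (hM : IsLocalizedIn X M)
    (hN : IsLocalizedIn Y N) (σ : Config q Λ) : (M * N) σ σ = M σ σ * N σ σ := by
  rw [Matrix.mul_apply, Finset.sum_eq_single σ]
  · intro τ _ hτ
    obtain ⟨x, hx⟩ := Function.ne_iff.1 hτ
    by_cases h : (x : Γ) ∈ X
    · rw [hN.apply_eq_zero (Finset.disjoint_left.1 hXY h) hx, mul_zero]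
    · rw [hM.apply_eq_zero h hx.symm, zero_mul]
  · simp

end LocalDynamics

/-! ### Diagonal vector states -/

section VectorState

variable {S : Type*} [Fintype S] [DecidableEq S]

/-- The diagonal matrix entry at `σ`, as a linear functional. -/
def entryFunctional (σ : S) : Matrix S S ℂ →ₗ[ℂ] ℂ where
  toFun M := M σ σ
  map_add' _ _ := rfl
  map_smul' _ _ := rfl

theorem isState_entryFunctional (σ : S) : IsState (entryFunctional σ) where
  map_one := Matrix.one_apply_eq σ
  nonneg M := by
    have h : entryFunctional σ (star M * M) = ((∑ τ, Complex.normSq (M τ σ) : ℝ) : ℂ) := by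
      change (star M * M) σ σ = _
      rw [Matrix.mul_apply, Complex.ofReal_sum]
      refine Finset.sum_congr rfl fun τ _ => ?_
      rw [Matrix.star_apply, RCLike.star_def, Complex.normSq_eq_conj_mul_self]
    rw [h, Complex.ofReal_re, Complex.ofReal_im]
    exact ⟨Finset.sum_nonneg fun τ _ => Complex.normSq_nonneg _, rfl⟩

theorem IsState.nonempty {π : Matrix S S ℂ →ₗ[ℂ] ℂ} (hπ : IsState π) : Nonempty S := by
  by_contra h
  rw [not_nonempty_iff] at h
  have h1 := hπ.map_one
  rw [Subsingleton.elim (1 : Matrix S S ℂ) 0, map_zero] at h1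
  exact zero_ne_one h1

end VectorState

/-! ### Locality of dissipative dynamics with power-law interactions -/

section Approximation

variable {Γ : Type*} [MetricSpace Γ] {κ ν α ε : ℝ}

/-- The power law with an additional exponential factor of range `R`. -/
def truncatedKernel (α R : ℝ) (x y : Γ) : ℝ := powerLaw α (dist x y) * Real.exp (-(dist x y / R))

theorem truncatedKernel_nonneg (α R : ℝ) (x y : Γ) : 0 ≤ truncatedKernel α R x y :=
  mul_nonneg (powerLaw_pos α dist_nonneg).le (Real.exp_pos _).le

/-- The triangle inequality lets the exponential factor pass through the convolution, so the
constant is that of the bare power law. -/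
theorem sum_truncatedKernel_mul_le (hC : convConst Γ (powerLaw α) < ⊤) {R : ℝ} (hR : 0 < R)
    (s : Finset Γ) (x y : Γ) :
    ∑ z ∈ s, truncatedKernel α R x z * truncatedKernel α R z y ≤
      (convConst Γ (powerLaw α)).toReal * truncatedKernel α R x y := by
  rw [truncatedKernel, ← mul_assoc]
  refine le_trans ?_ (mul_le_mul_of_nonneg_right (sum_powerLaw_mul_le hC s x y)
    (Real.exp_pos _).le)
  rw [Finset.sum_mul]
  refine Finset.sum_le_sum fun z _ => ?_
  rw [truncatedKernel, truncatedKernel, mul_mul_mul_comm, ← Real.exp_add]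
  refine mul_le_mul_of_nonneg_left (Real.exp_le_exp.2 ?_)
    (mul_nonneg (powerLaw_pos α dist_nonneg).le (powerLaw_pos α dist_nonneg).le)
  rw [← neg_add, ← add_div, neg_le_neg_iff]
  exact div_le_div_of_nonneg_right (dist_triangle x z y) hR.le

variable [DecidableEq Γ] {q : Γ → ℕ} {L : DissipativeInteraction q} {Λ : Finset Γ}

theorem localGenerators_localMap (hL : interactionNorm (powerLaw α) L < ⊤) (Λ : Finset Γ) :
    LocalGenerators (localMap L Λ) (fun Z => Z.1) (fun Z => (cbNorm (L.map Z.1)).toReal) Λ where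
  nonneg _ := ENNReal.toReal_nonneg
  norm_le Z M := by
    obtain ⟨Z, hZ⟩ := Z
    rcases Z.eq_empty_or_nonempty with rfl | hne
    · rw [localMap_apply, extend_empty (L.lindblad ∅)]
      simpa using mul_nonneg ENNReal.toReal_nonneg (norm_nonneg M)
    · exact norm_extend_le _ (cbNorm_lt_top hL hne) M
  supp_subset Z := Finset.mem_powerset.1 Z.2
  commute Z W hd := by
    ext1 M
    exact extend_comm _ _ hd (L.lindblad Z.1) (L.lindblad W.1) M
  contraction J s hs := by
    have h : ∑ j ∈ J, localMap L Λ j = LinearMap.toContinuousLinearMap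
        (∑ j ∈ J, extend (Finset.mem_powerset.1 j.2) (L.map j.1)) := by
      rw [map_sum]
      rfl
    rw [h]
    exact (IsLindblad.sum J fun j _ => isLindblad_extend _ (L.lindblad j.1)).norm_flow_le_one hs

/-- Replacing the full dynamics by the dynamics generated by a family `J` of sets of diameter at
most `R` contained in `Ω`, on observables localized in `X`. -/
theorem norm_flow_sub_flow_le [Nonempty Γ] (hΓ : IsRegularSpace Γ κ ν) (hε : 0 < ε)
    (hα : 0 ≤ reducedExponent α ν ε) (hL : interactionNorm (powerLaw α) L < ⊤)
    {X Ω : Finset Γ} (hX : X ⊆ Λ) (hXΩ : X ⊆ Ω) {r R : ℝ} (hr : 0 ≤ r) (hR : 0 < R)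
    {J : Finset {Z // Z ∈ Λ.powerset}} (hJΩ : ∀ Z ∈ J, Z.1 ⊆ Ω)
    (hJR : ∀ Z ∈ J, ∀ y ∈ Z.1, ∀ z ∈ Z.1, dist y z ≤ R)
    (hfar : ∀ Z ∉ J, (∀ y ∈ Z.1, ∀ z ∈ Z.1, dist y z ≤ R) → ∀ x ∈ X, ∃ y ∈ Z.1, r ≤ dist x y)
    {M : Obs q Λ} (hM : IsLocalizedIn X M) {t : ℝ} (ht : 0 ≤ t) :
    ‖flow (∑ Z, localMap L Λ Z) t M - flow (∑ Z ∈ J, localMap L Λ Z) t M‖ ≤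
      ‖M‖ * (interactionNorm (powerLaw α) L).toReal * (κ * zetaConst ε) *
        (Ω.card * (1 + R / 2) ^ (-reducedExponent α ν ε) +
          X.card * Real.exp 1 * Real.exp (Real.exp 1 * velocity α L * t - r / R) *
            (1 + r) ^ (-reducedExponent α ν ε)) * t := by
  set l := (interactionNorm (powerLaw α) L).toReal with hl
  set C := (convConst Γ (powerLaw α)).toReal with hCdef
  have hl0 : 0 ≤ l := ENNReal.toReal_nonneg
  have hκ := hΓ.kappa_pos.le
  have hζ := zetaConst_nonneg ε
  have hD := localGenerators_localMap (q := q) hL Λ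
  have ha : ∀ Z : {Z // Z ∈ Λ.powerset}, Disjoint Z.1 X → localMap L Λ Z M = 0 := fun Z hd =>
    hM.localMap_eq_zero Z hd
  refine hD.norm_flow_sub_flow_le (Finset.subset_univ J) M ht fun s hs => ?_
  have hCtop := hΓ.convConst_lt_top hε hα
  have hC1 : 1 ≤ C := by
    have := ENNReal.toReal_mono hCtop.ne (one_le_convConst (Γ := Γ) α)
    simpa using this
  have hC0 : 0 < C := by linarith
  have hinj : Function.Injective fun Z : {Z // Z ∈ Λ.powerset} => Z.1 := Subtype.val_injective
  -- `I` collects all short sets. Removed generators split into the long ones, outside `I`, and the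
  -- short ones in `I \ J`.
  let I : Finset {Z // Z ∈ Λ.powerset} :=
    Finset.univ.filter fun Z => ∀ y ∈ Z.1, ∀ z ∈ Z.1, dist y z ≤ R
  have hJI : J ⊆ I := fun Z hZ => Finset.mem_filter.2 ⟨Finset.mem_univ _, hJR Z hZ⟩
  have hIk : ∀ y ∈ Λ, ∀ z ∈ Λ, ∑ i ∈ I with y ∈ i.1 ∧ z ∈ i.1, (cbNorm (L.map i.1)).toReal ≤
      l * Real.exp 1 * truncatedKernel α R y z := by
    intro y _ z _
    rcases Finset.eq_empty_or_nonempty {i ∈ I | y ∈ i.1 ∧ z ∈ i.1} with h | ⟨i, hi⟩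
    · rw [h, Finset.sum_empty]
      exact mul_nonneg (mul_nonneg hl0 (Real.exp_pos _).le) (truncatedKernel_nonneg α R y z)
    · obtain ⟨hiI, hy, hz⟩ := Finset.mem_filter.1 hi
      have hd : dist y z ≤ R := (Finset.mem_filter.1 hiI).2 y hy z hz
      refine (sum_cbNorm_le hL _ hinj y z fun i hi => (Finset.mem_filter.1 hi).2).trans ?_
      -- A short set joins only points with `dist y z ≤ R`, so inserting `exp (-d / R)` costs at
      -- most the factor `e`.
      have h1 : (1 : ℝ) ≤ Real.exp 1 * Real.exp (-(dist y z / R)) := by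
        rw [← Real.exp_add]
        refine Real.one_le_exp ?_
        rw [← sub_eq_add_neg, sub_nonneg, div_le_one hR]
        exact hd
      have h2 : 0 ≤ l * powerLaw α (dist y z) := mul_nonneg hl0 (powerLaw_pos α dist_nonneg).le
      calc l * powerLaw α (dist y z)
          ≤ l * powerLaw α (dist y z) * (Real.exp 1 * Real.exp (-(dist y z / R))) :=
            le_mul_of_one_le_right h2 h1
        _ = _ := by rw [truncatedKernel]; ring
  have hshort : ∑ i ∈ I \ J, ‖localMap L Λ i (flow (∑ Z ∈ J, localMap L Λ Z) s M)‖ ≤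
      ‖M‖ * l * (κ * zetaConst ε) * (X.card * Real.exp 1 *
        Real.exp (Real.exp 1 * velocity α L * t - r / R) *
          (1 + r) ^ (-reducedExponent α ν ε)) := by
    refine (hD.sum_norm_apply_flow_le hJI Finset.sdiff_subset (truncatedKernel_nonneg α R)
      (mul_nonneg hl0 (Real.exp_pos 1).le) hC0 (sum_truncatedKernel_mul_le hCtop hR Λ) hIk hX ha
      (far := fun x => {y ∈ Λ | r ≤ dist x y}) (fun x hx i hi => ?_) hs.1).trans ?_
    · obtain ⟨hiI, hiJ⟩ := Finset.mem_sdiff.1 hi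
      obtain ⟨y, hy, hxy⟩ := hfar i hiJ (Finset.mem_filter.1 hiI).2 x hx
      exact ⟨y, hy, Finset.mem_filter.2 ⟨Finset.mem_powerset.1 i.2 hy, hxy⟩⟩
    · have h1 : ∀ x ∈ X, ∑ y ∈ Λ with y ∈ {y ∈ Λ | r ≤ dist x y}, truncatedKernel α R y x ≤
          Real.exp (-(r / R)) * (κ * zetaConst ε * (1 + r) ^ (-reducedExponent α ν ε)) := by
        intro x _
        have hy : ∀ y ∈ Λ.filter (fun y => y ∈ Λ.filter fun y => r ≤ dist x y), r ≤ dist x y :=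
          fun y hy => (Finset.mem_filter.1 (Finset.mem_filter.1 hy).2).2
        refine le_trans ?_ (mul_le_mul_of_nonneg_left
          (hΓ.sum_powerLaw_le hε hα _ x hr hy) (Real.exp_pos _).le)
        rw [Finset.mul_sum]
        refine Finset.sum_le_sum fun y hy' => ?_
        rw [truncatedKernel, dist_comm, mul_comm]
        refine mul_le_mul_of_nonneg_right (Real.exp_le_exp.2 (neg_le_neg ?_))
          (powerLaw_pos α dist_nonneg).le
        exact div_le_div_of_nonneg_right (hy y hy') hR.le
      have h2 : Real.exp (l * Real.exp 1 * C * s) ≤ Real.exp (Real.exp 1 * velocity α L * t) := by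
        refine Real.exp_le_exp.2 ?_
        have : Real.exp 1 * velocity α L * t = l * Real.exp 1 * C * t := by
          rw [velocity]; ring
        rw [this]
        exact mul_le_mul_of_nonneg_left hs.2
          (mul_nonneg (mul_nonneg hl0 (Real.exp_pos 1).le) hC0.le)
      calc _ ≤ ‖M‖ * (l * Real.exp 1) * Real.exp (Real.exp 1 * velocity α L * t) *
            ∑ x ∈ X, Real.exp (-(r / R)) *
              (κ * zetaConst ε * (1 + r) ^ (-reducedExponent α ν ε)) := by
            refine mul_le_mul (mul_le_mul_of_nonneg_left h2 (by positivity))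
              (Finset.sum_le_sum h1) ?_ (by positivity)
            exact Finset.sum_nonneg fun x _ => Finset.sum_nonneg fun y _ =>
              truncatedKernel_nonneg α R y x
        _ = _ := by
            rw [Finset.sum_const, nsmul_eq_mul, sub_eq_add_neg, Real.exp_add]
            ring
  have hlong : ∑ i ∈ Finset.univ \ I, ‖localMap L Λ i (flow (∑ Z ∈ J, localMap L Λ Z) s M)‖ ≤
      ‖M‖ * l * (κ * zetaConst ε) * (Ω.card * (1 + R / 2) ^ (-reducedExponent α ν ε)) := by
    refine (hD.sum_norm_apply_flow_le_of_subset hXΩ hJΩ ha hs.1).trans ?_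
    have h1 : ∀ z ∈ Ω, ∑ i ∈ Finset.univ \ I with z ∈ i.1, (cbNorm (L.map i.1)).toReal ≤
        l * (κ * zetaConst ε * (1 + R / 2) ^ (-reducedExponent α ν ε)) := by
      intro z _
      -- Two points more than `R` apart cannot both be closer than `R / 2` to `z`.
      have hpt : ∀ i ∈ (Finset.univ \ I).filter (fun i => z ∈ i.1),
          ∃ y ∈ Λ.filter (fun y => R / 2 ≤ dist z y), y ∈ i.1 := by
        intro i hi
        obtain ⟨hiI, hz⟩ := Finset.mem_filter.1 hi
        have hlongi : ¬ ∀ y ∈ i.1, ∀ w ∈ i.1, dist y w ≤ R := fun h =>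
          (Finset.mem_sdiff.1 hiI).2 (Finset.mem_filter.2 ⟨Finset.mem_univ _, h⟩)
        push Not at hlongi
        obtain ⟨y, hy, w, hw, hyw⟩ := hlongi
        have htri := dist_triangle_left y w z
        rcases le_total (R / 2) (dist z y) with h | h
        · exact ⟨y, Finset.mem_filter.2 ⟨Finset.mem_powerset.1 i.2 hy, h⟩, hy⟩
        · exact ⟨w, Finset.mem_filter.2 ⟨Finset.mem_powerset.1 i.2 hw, by linarith⟩, hw⟩
      calc ∑ i ∈ Finset.univ \ I with z ∈ i.1, (cbNorm (L.map i.1)).toReal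
          ≤ ∑ i ∈ Finset.univ \ I with z ∈ i.1, ∑ y ∈ Λ with R / 2 ≤ dist z y,
              if y ∈ i.1 then (cbNorm (L.map i.1)).toReal else 0 := by
            refine Finset.sum_le_sum fun i hi => ?_
            obtain ⟨y, hy, hyi⟩ := hpt i hi
            refine le_trans (le_of_eq (if_pos hyi).symm) (Finset.single_le_sum (f := fun y =>
              if y ∈ i.1 then (cbNorm (L.map i.1)).toReal else 0) (fun w _ => ?_) hy)
            split_ifs
            exacts [ENNReal.toReal_nonneg, le_rfl]
        _ = ∑ y ∈ Λ with R / 2 ≤ dist z y,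
              ∑ i ∈ {i ∈ Finset.univ \ I | z ∈ i.1} with y ∈ i.1,
                (cbNorm (L.map i.1)).toReal := by
            rw [Finset.sum_comm]
            exact Finset.sum_congr rfl fun y _ => (Finset.sum_filter _ _).symm
        _ ≤ ∑ y ∈ Λ with R / 2 ≤ dist z y, l * powerLaw α (dist z y) := by
            refine Finset.sum_le_sum fun y _ => sum_cbNorm_le hL _ hinj z y fun i hi => ?_
            exact ⟨(Finset.mem_filter.1 (Finset.mem_filter.1 hi).1).2, (Finset.mem_filter.1 hi).2⟩
        _ ≤ _ := by
            rw [← Finset.mul_sum]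
            exact mul_le_mul_of_nonneg_left (hΓ.sum_powerLaw_le hε hα _ z (half_pos hR).le
              fun y hy => (Finset.mem_filter.1 hy).2) hl0
    calc _ ≤ ‖M‖ * ∑ z ∈ Ω, l * (κ * zetaConst ε * (1 + R / 2) ^ (-reducedExponent α ν ε)) :=
          mul_le_mul_of_nonneg_left (Finset.sum_le_sum h1) (norm_nonneg M)
      _ = _ := by
          rw [Finset.sum_const, nsmul_eq_mul]
          ring
  have hsplit : (Finset.univ \ J : Finset {Z // Z ∈ Λ.powerset}) =
      (Finset.univ \ I) ∪ (I \ J) :=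
    (Finset.sdiff_union_sdiff_cancel (Finset.subset_univ I) hJI).symm
  rw [hsplit, Finset.sum_union (Finset.sdiff_disjoint.mono_right Finset.sdiff_subset)]
  refine (add_le_add hlong hshort).trans (le_of_eq ?_)
  ring

end Approximation

/-! ### Choice of scales and constants -/

section Correlations

variable {Γ : Type*} [MetricSpace Γ] {κ ν α ε δ η : ℝ}

theorem setDist_le {X Y : Finset Γ} {x y : Γ} (hx : x ∈ X) (hy : y ∈ Y) :
    setDist X Y ≤ dist x y := by
  refine csInf_le ⟨0, ?_⟩ ⟨x, hx, y, hy, rfl⟩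
  rintro r ⟨x, -, y, -, rfl⟩
  exact dist_nonneg

theorem nonempty_of_setDist_pos {X Y : Finset Γ} (h : 0 < setDist X Y) : Nonempty Γ := by
  rcases X.eq_empty_or_nonempty with rfl | ⟨x, -⟩
  · simp [setDist] at h
  · exact ⟨x⟩

/-- Subadditivity of the power `1 - δ` gives `(1 + r) ^ (1 - δ) ≤ 1 + r ^ (1 - δ)`; this turns decay
in the range into decay in `r`. -/
theorem rpow_neg_half_range_le {r : ℝ} (hr : 0 ≤ r) (hδ0 : 0 ≤ δ) (hδ1 : δ ≤ 1) {a : ℝ}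
    (ha : 0 ≤ a) :
    (1 + r ^ (1 - δ) / 2) ^ (-a) ≤ 2 ^ a * (1 + r) ^ (-((1 - δ) * a)) := by
  have h1 : (1 + r) ^ (1 - δ) ≤ 1 + r ^ (1 - δ) := by
    have := Real.rpow_add_le_add_rpow zero_le_one hr (by linarith : 0 ≤ 1 - δ) (by linarith)
    rwa [Real.one_rpow] at this
  have h2 : 0 < (1 + r) ^ (1 - δ) := Real.rpow_pos_of_pos (by linarith) _
  have e : 2 ^ a * (1 + r) ^ (-((1 - δ) * a)) = ((1 + r) ^ (1 - δ) / 2) ^ (-a) := by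
    rw [Real.div_rpow h2.le zero_le_two, ← Real.rpow_mul (by linarith : 0 ≤ 1 + r),
      Real.rpow_neg zero_le_two, div_inv_eq_mul, mul_comm, mul_neg]
  rw [e]
  refine Real.rpow_le_rpow_of_nonpos (by positivity) ?_ (by linarith)
  have := Real.rpow_nonneg hr (1 - δ)
  linarith

/-- The time `r ^ η` consumes `η` of the decay exponent, and `1 + 2 * r ≤ 2 * (1 + r)` passes to the
full distance `2 * r`. This is the source of the power of `2` in `correlationConst`. -/
theorem time_mul_rpow_le {r p : ℝ} (hr : 0 ≤ r) (hη : 0 ≤ η) (hp : η ≤ p) :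
    r ^ η * (1 + r) ^ (-p) ≤ 2 ^ (p - η) * (1 / (1 + 2 * r) ^ (p - η)) := by
  have h1 : r ^ η * (1 + r) ^ (-p) ≤ (1 + r) ^ (-(p - η)) := by
    calc r ^ η * (1 + r) ^ (-p) ≤ (1 + r) ^ η * (1 + r) ^ (-p) := by
          gcongr
          linarith
      _ = _ := by
          rw [← Real.rpow_add (by linarith)]
          congr 1
          ring
  refine h1.trans ?_
  rw [mul_one_div, ← Real.div_rpow zero_le_two (by linarith), Real.rpow_neg (by linarith),
    ← Real.inv_rpow (by linarith)]
  refine Real.rpow_le_rpow (by positivity) ?_ (by linarith)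
  rw [inv_eq_one_div, div_le_div_iff₀ (by linarith) (by linarith)]
  linarith

/-- The argument produces the smaller left-hand constant; enlarging each summand separately gives
the stated one. -/
theorem prefactor_le_localityConst [Nonempty Γ] (hΓ : IsRegularSpace Γ κ ν) (hε : 0 < ε)
    (hα : 0 ≤ reducedExponent α ν ε) (hδ : δ ≤ 1) :
    κ * zetaConst ε * (κ * 2 ^ reducedExponent α ν ε + Real.exp 1) ≤
      localityConst Γ κ ν α ε δ := by
  set C := (convConst Γ (powerLaw α)).toReal with hC
  set F := (decaySum Γ (powerLaw α)).toReal with hF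
  have hF0 : 0 ≤ F := ENNReal.toReal_nonneg
  have hC1 : 1 ≤ C := by
    have := ENNReal.toReal_mono (hΓ.convConst_lt_top hε hα).ne (one_le_convConst (Γ := Γ) α)
    simpa using this
  have hκ := hΓ.kappa_pos
  have hζ := zetaConst_nonneg ε
  have e : localityConst Γ κ ν α ε δ = κ * zetaConst ε *
      (κ * (2 ^ (2 * reducedExponent α ν ε) * 2 ^ (1 - δ) * ((zetaConst ε + C) / C)) +
        Real.exp 1 * ((C + F) / C)) := by
    rw [localityConst]
    ring
  rw [e]
  have h1 : (2 : ℝ) ^ reducedExponent α ν ε ≤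
      2 ^ (2 * reducedExponent α ν ε) * 2 ^ (1 - δ) * ((zetaConst ε + C) / C) := by
    have h2 : (2 : ℝ) ^ reducedExponent α ν ε ≤ 2 ^ (2 * reducedExponent α ν ε) :=
      Real.rpow_le_rpow_of_exponent_le one_le_two (by linarith)
    have h3 : (1 : ℝ) ≤ 2 ^ (1 - δ) := Real.one_le_rpow one_le_two (by linarith)
    have h4 : 1 ≤ (zetaConst ε + C) / C := by
      rw [one_le_div (by linarith)]; linarith
    rw [mul_assoc]
    exact h2.trans (le_mul_of_one_le_right (by positivity) (one_le_mul_of_one_le_of_one_le h3 h4))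
  have h5 : Real.exp 1 ≤ Real.exp 1 * ((C + F) / C) := by
    refine le_mul_of_one_le_right (Real.exp_pos 1).le ?_
    rw [one_le_div (by linarith)]; linarith
  gcongr

theorem velocity_pos [DecidableEq Γ] {q : Γ → ℕ} [Nonempty Γ] (hΓ : IsRegularSpace Γ κ ν)
    (hε : 0 < ε) (hα : 0 ≤ reducedExponent α ν ε) {L : DissipativeInteraction q}
    (hL : interactionNorm (powerLaw α) L < ⊤) (hL0 : 0 < interactionNorm (powerLaw α) L) :
    0 < velocity α L :=
  mul_pos (ENNReal.toReal_pos hL0.ne' hL.ne) <| ENNReal.toReal_pos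
    (zero_lt_one.trans_le (one_le_convConst α)).ne' (hΓ.convConst_lt_top hε hα).ne

theorem correlationConst_nonneg [DecidableEq Γ] {q : Γ → ℕ} [Nonempty Γ]
    (hΓ : IsRegularSpace Γ κ ν) (hε : 0 < ε) (hα : 0 ≤ reducedExponent α ν ε) (hδ : δ ≤ 1)
    (η : ℝ) (L : DissipativeInteraction q) : 0 ≤ correlationConst κ ν α ε δ η L := by
  have hκ := hΓ.kappa_pos
  have hζ := zetaConst_nonneg ε
  have h1 : 0 ≤ localityConst Γ κ ν α ε δ :=
    le_trans (by positivity) (prefactor_le_localityConst (α := α) hΓ hε hα hδ)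
  have h2 : 0 ≤ velocity α L := mul_nonneg ENNReal.toReal_nonneg ENNReal.toReal_nonneg
  unfold correlationConst
  positivity

/-- The open `r`-neighbourhood of `X` in `Λ`. -/
def neighbourhood {Γ : Type*} [MetricSpace Γ] (Λ X : Finset Γ) (r : ℝ) : Finset Γ :=
  open scoped Classical in {z ∈ Λ | ∃ x ∈ X, dist x z < r}

theorem mem_neighbourhood {Λ X : Finset Γ} {r : ℝ} {z : Γ} :
    z ∈ neighbourhood Λ X r ↔ z ∈ Λ ∧ ∃ x ∈ X, dist x z < r := by
  simp [neighbourhood]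

theorem subset_neighbourhood {Λ X : Finset Γ} (hX : X ⊆ Λ) {r : ℝ} (hr : 0 < r) :
    X ⊆ neighbourhood Λ X r := fun x hx =>
  mem_neighbourhood.2 ⟨hX hx, x, hx, by rwa [dist_self]⟩

theorem card_neighbourhood_le [DecidableEq Γ] (hΓ : IsRegularSpace Γ κ ν) (Λ X : Finset Γ) {r : ℝ} (hr : 0 ≤ r) :
    ((neighbourhood Λ X r).card : ℝ) ≤ X.card * (κ * (1 + r) ^ ν) := by
  have hsub : neighbourhood Λ X r ⊆ X.biUnion fun x => {z ∈ Λ | dist x z < r} := by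
    intro z hz
    obtain ⟨hz, x, hx, hd⟩ := mem_neighbourhood.1 hz
    exact Finset.mem_biUnion.2 ⟨x, hx, Finset.mem_filter.2 ⟨hz, hd⟩⟩
  calc ((neighbourhood Λ X r).card : ℝ)
      ≤ ∑ x ∈ X, (Finset.card {z ∈ Λ | dist x z < r} : ℝ) := by
        exact_mod_cast (Finset.card_le_card hsub).trans Finset.card_biUnion_le
    _ ≤ ∑ _x ∈ X, κ * (1 + r) ^ ν := Finset.sum_le_sum fun x _ =>
        hΓ.card_le_of_dist_lt _ x hr fun y hy => (Finset.mem_filter.1 hy).2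
    _ = _ := by rw [Finset.sum_const, nsmul_eq_mul]

theorem disjoint_neighbourhood {Λ X Y : Finset Γ} {r : ℝ}
    (h : ∀ x ∈ X, ∀ y ∈ Y, 2 * r ≤ dist x y) :
    Disjoint (neighbourhood Λ X r) (neighbourhood Λ Y r) := by
  refine Finset.disjoint_left.2 fun z hzX hzY => ?_
  obtain ⟨-, x, hx, hxz⟩ := mem_neighbourhood.1 hzX
  obtain ⟨-, y, hy, hyz⟩ := mem_neighbourhood.1 hzY
  have h1 := h x hx y hy
  have h2 := dist_triangle_right x y z
  linarith

variable [DecidableEq Γ] {q : Γ → ℕ}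

/-- The dynamics generated by the sets of diameter at most `r ^ (1 - δ)` inside the
`r`-neighbourhood of `X` or inside that of `Y` approximates the full dynamics on observables in
`X ∪ Y` up to the time `r ^ η / (e v)`. -/
theorem norm_flow_sub_decoupled_flow_le [Nonempty Γ] (hΓ : IsRegularSpace Γ κ ν) (hε : 0 < ε)
    (hα : 0 ≤ reducedExponent α ν ε) {L : DissipativeInteraction q}
    (hL : interactionNorm (powerLaw α) L < ⊤) (hL0 : 0 < interactionNorm (powerLaw α) L)
    (hδ0 : 0 ≤ δ) (hδ1 : δ ≤ 1) (hη : 0 ≤ η) (hηδ : η ≤ δ)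
    (hηp : η ≤ (1 - δ) * reducedExponent α ν ε - ν) {Λ X Y : Finset Γ}
    (hX : X ⊆ Λ) (hY : Y ⊆ Λ) {r : ℝ} (hr : 1 ≤ r) {J : Finset {Z // Z ∈ Λ.powerset}}
    (hJ : ∀ Z, Z ∈ J ↔ (∀ y ∈ Z.1, ∀ z ∈ Z.1, dist y z ≤ r ^ (1 - δ)) ∧
      (Z.1 ⊆ neighbourhood Λ X r ∨ Z.1 ⊆ neighbourhood Λ Y r))
    {M : Obs q Λ} (hM : IsLocalizedIn (X ∪ Y) M) :
    3 * ‖flow (∑ Z, localMap L Λ Z) (r ^ η / (Real.exp 1 * velocity α L)) M -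
      flow (∑ Z ∈ J, localMap L Λ Z) (r ^ η / (Real.exp 1 * velocity α L)) M‖ ≤
      correlationConst κ ν α ε δ η L * ‖M‖ * ((X.card : ℝ) + Y.card) *
        (interactionNorm (powerLaw α) L).toReal *
        (1 / (1 + 2 * r) ^ ((1 - δ) * reducedExponent α ν ε - ν - η)) := by
  set a := reducedExponent α ν ε with ha
  set p := (1 - δ) * a - ν with hp
  set l := (interactionNorm (powerLaw α) L).toReal with hl
  set v := velocity α L with hv
  have hv0 : 0 < v := velocity_pos hΓ hε hα hL hL0
  have hl0 : 0 ≤ l := ENNReal.toReal_nonneg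
  have hr0 : 0 < r := by linarith
  have hκ := hΓ.kappa_pos
  have hζ := zetaConst_nonneg ε
  have he := Real.exp_pos 1
  set n : ℝ := (X.card : ℝ) + Y.card with hn
  have hn0 : 0 ≤ n := by positivity
  set R := r ^ (1 - δ) with hR
  have hR0 : 0 < R := Real.rpow_pos_of_pos hr0 _
  set t := r ^ η / (Real.exp 1 * v) with ht
  have ht0 : 0 ≤ t := by positivity
  set NX := neighbourhood Λ X r with hNX
  set NY := neighbourhood Λ Y r with hNY
  have h1 := norm_flow_sub_flow_le (q := q) hΓ hε hα hL (X := X ∪ Y) (Ω := NX ∪ NY)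
    (Finset.union_subset hX hY)
    (Finset.union_subset_union (subset_neighbourhood hX hr0) (subset_neighbourhood hY hr0))
    hr0.le hR0 (J := J)
    (fun Z hZ => ((hJ Z).1 hZ).2.elim (fun h => h.trans Finset.subset_union_left)
      fun h => h.trans Finset.subset_union_right)
    (fun Z hZ => ((hJ Z).1 hZ).1)
    (fun Z hZ hs x hx => by
      have hnot : ¬ (Z.1 ⊆ NX ∨ Z.1 ⊆ NY) := fun h => hZ ((hJ Z).2 ⟨hs, h⟩)
      rw [not_or, Finset.not_subset, Finset.not_subset] at hnot
      have hfar : ∀ W : Finset Γ, x ∈ W → (∃ y ∈ Z.1, y ∉ neighbourhood Λ W r) →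
          ∃ y ∈ Z.1, r ≤ dist x y := by
        rintro W hxW ⟨y, hy, hyW⟩
        refine ⟨y, hy, not_lt.1 fun hlt => hyW ?_⟩
        exact mem_neighbourhood.2 ⟨Finset.mem_powerset.1 Z.2 hy, x, hxW, hlt⟩
      rcases Finset.mem_union.1 hx with h | h
      · exact hfar X h hnot.1
      · exact hfar Y h hnot.2) hM ht0
  have hcardN : ((NX ∪ NY).card : ℝ) ≤ n * (κ * (1 + r) ^ ν) := by
    calc ((NX ∪ NY).card : ℝ) ≤ NX.card + NY.card := by exact_mod_cast Finset.card_union_le _ _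
      _ ≤ X.card * (κ * (1 + r) ^ ν) + Y.card * (κ * (1 + r) ^ ν) :=
        add_le_add (card_neighbourhood_le hΓ Λ X hr0.le) (card_neighbourhood_le hΓ Λ Y hr0.le)
      _ = _ := by rw [hn]; ring
  have hcard : ((X ∪ Y).card : ℝ) ≤ n := by rw [hn]; exact_mod_cast Finset.card_union_le X Y
  -- The exponent equals `r ^ η - r ^ δ`, which is nonpositive because `1 ≤ r` and `η ≤ δ`.
  have hexp : Real.exp (Real.exp 1 * v * t - r / R) ≤ 1 := by
    rw [Real.exp_le_one_iff, sub_nonpos]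
    have h2 : Real.exp 1 * v * t = r ^ η := by
      rw [ht]; field_simp
    have h3 : r / R = r ^ δ := by
      rw [hR, div_eq_iff (Real.rpow_pos_of_pos hr0 _).ne', ← Real.rpow_add hr0]
      simp
    rw [h2, h3]
    exact Real.rpow_le_rpow_of_exponent_le hr hηδ
  have hpa : (1 + r) ^ (-a) ≤ (1 + r) ^ (-p) := by
    refine Real.rpow_le_rpow_of_exponent_le (by linarith) ?_
    have := mul_nonneg hδ0 hα
    have := hΓ.nu_pos
    rw [hp]
    linarith
  -- The volume of the neighbourhoods costs `ν`, leaving `p = (1 - δ) * a - ν`.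
  have hvol : (1 + r) ^ ν * (1 + R / 2) ^ (-a) ≤ 2 ^ a * (1 + r) ^ (-p) := by
    calc (1 + r) ^ ν * (1 + R / 2) ^ (-a)
        ≤ (1 + r) ^ ν * (2 ^ a * (1 + r) ^ (-((1 - δ) * a))) :=
          mul_le_mul_of_nonneg_left (rpow_neg_half_range_le hr0.le hδ0 hδ1 hα) (by positivity)
      _ = 2 ^ a * ((1 + r) ^ ν * (1 + r) ^ (-((1 - δ) * a))) := by ring
      _ = _ := by
          rw [← Real.rpow_add (by linarith), hp]
          congr 2
          ring
  have hsum : ((NX ∪ NY).card : ℝ) * (1 + R / 2) ^ (-a) + (X ∪ Y).card * Real.exp 1 *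
      Real.exp (Real.exp 1 * v * t - r / R) * (1 + r) ^ (-a) ≤
      n * (κ * 2 ^ a + Real.exp 1) * (1 + r) ^ (-p) := by
    have h4 : ((NX ∪ NY).card : ℝ) * (1 + R / 2) ^ (-a) ≤ n * κ * (2 ^ a * (1 + r) ^ (-p)) := by
      calc ((NX ∪ NY).card : ℝ) * (1 + R / 2) ^ (-a)
          ≤ n * (κ * (1 + r) ^ ν) * (1 + R / 2) ^ (-a) :=
            mul_le_mul_of_nonneg_right hcardN (by positivity)
        _ = n * κ * ((1 + r) ^ ν * (1 + R / 2) ^ (-a)) := by ring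
        _ ≤ _ := mul_le_mul_of_nonneg_left hvol (by positivity)
    have h5 : ((X ∪ Y).card : ℝ) * Real.exp 1 * Real.exp (Real.exp 1 * v * t - r / R) *
        (1 + r) ^ (-a) ≤ n * Real.exp 1 * 1 * (1 + r) ^ (-p) := by
      gcongr
    linarith
  have hC := prefactor_le_localityConst (α := α) hΓ hε hα hδ1
  have htime := time_mul_rpow_le hr0.le hη hηp
  have hC0 : 0 ≤ localityConst Γ κ ν α ε δ := le_trans (by positivity) hC
  calc 3 * ‖flow (∑ Z, localMap L Λ Z) t M - flow (∑ Z ∈ J, localMap L Λ Z) t M‖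
      ≤ 3 * (‖M‖ * l * (κ * zetaConst ε) * (n * (κ * 2 ^ a + Real.exp 1) * (1 + r) ^ (-p)) * t) := by
        refine mul_le_mul_of_nonneg_left (h1.trans ?_) (by norm_num)
        gcongr
    _ = 3 * ‖M‖ * n * l * (κ * zetaConst ε * (κ * 2 ^ a + Real.exp 1)) *
          ((r ^ η * (1 + r) ^ (-p)) / (Real.exp 1 * v)) := by
        rw [ht]; ring
    _ ≤ 3 * ‖M‖ * n * l * localityConst Γ κ ν α ε δ *
          ((2 ^ (p - η) * (1 / (1 + 2 * r) ^ (p - η))) / (Real.exp 1 * v)) := by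
        gcongr
    _ = _ := by
        rw [correlationConst]
        ring

end Correlations

end OpenSpin

end

/-! ### Decay of correlations in the fixed point -/

theorem lemma3p6 {Γ : Type*} [DecidableEq Γ] [Countable Γ] [MetricSpace Γ] {q : Γ → ℕ}
    {κ ν : ℝ} (hΓ : OpenSpin.IsRegularSpace Γ κ ν)
    {α : ℝ} (hα : 2 * ν + 1 < α)
    (L : OpenSpin.DissipativeInteraction q)
    (hL : OpenSpin.interactionNorm (OpenSpin.powerLaw α) L < ⊤)
    (hL0 : 0 < OpenSpin.interactionNorm (OpenSpin.powerLaw α) L)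
    {ε : ℝ} (hε : ε ∈ Set.Ioo 0 (α - 2 * ν - 1))
    {δ : ℝ} (hδ : δ ∈ Set.Ioo (0 : ℝ) 1) (hδα : ν < (1 - δ) * OpenSpin.reducedExponent α ν ε)
    (Λ : Finset Γ) (π : OpenSpin.Obs q Λ →ₗ[ℂ] ℂ) (g : ℝ → ℝ)
    (hπ : OpenSpin.IsLocalDynamicalFixedPoint L Λ π g)
    (X Y : Finset Γ) (hX : X ⊆ Λ) (hY : Y ⊆ Λ) (hXY : 2 < OpenSpin.setDist X Y)
    (A : OpenSpin.Obs q X) (B : OpenSpin.Obs q Y)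
    {η : ℝ} (hη : 0 < η) (hη' : η < min δ ((1 - δ) * OpenSpin.reducedExponent α ν ε - ν)) :
    ‖π (OpenSpin.embed hX A * OpenSpin.embed hY B) -
        π (OpenSpin.embed hX A) * π (OpenSpin.embed hY B)‖ ≤
      OpenSpin.correlationConst κ ν α ε δ η L * ‖A‖ * ‖B‖ * ((X.card : ℝ) + (Y.card : ℝ)) *
          (OpenSpin.interactionNorm (OpenSpin.powerLaw α) L).toReal *
          (1 / (1 + OpenSpin.setDist X Y) ^ ((1 - δ) * OpenSpin.reducedExponent α ν ε - ν - η)) +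
        3 * ‖A‖ * ‖B‖ *
          g (OpenSpin.setDist X Y ^ η / (Real.exp 1 * OpenSpin.velocity α L * 2 ^ η)) := by
  classical
  open OpenSpin in
  have : Nonempty Γ := nonempty_of_setDist_pos (X := X) (Y := Y) (by linarith)
  have hν := hΓ.nu_pos
  have hα0 : 0 ≤ reducedExponent α ν ε := by
    have := hε.2
    unfold reducedExponent
    linarith
  -- Half the distance, so that the open `r`-neighbourhoods are disjoint; distance above `2` gives
  -- `1 ≤ r`.
  obtain ⟨r, hr⟩ : ∃ r, r = setDist X Y / 2 := ⟨_, rfl⟩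
  have hr1 : 1 ≤ r := by linarith
  have hd : setDist X Y = 2 * r := by linarith
  have hv0 : 0 < velocity α L := velocity_pos hΓ hε.1 hα0 hL hL0
  set t := r ^ η / (Real.exp 1 * velocity α L) with ht
  have htime : setDist X Y ^ η / (Real.exp 1 * velocity α L * 2 ^ η) = t := by
    rw [hd, Real.mul_rpow zero_le_two (by linarith), ht]
    have : (2 : ℝ) ^ η ≠ 0 := (Real.rpow_pos_of_pos two_pos η).ne'
    field_simp
  have ht0 : 0 ≤ t := div_nonneg (Real.rpow_nonneg (by linarith) _) (by positivity)
  have hdisj : Disjoint (neighbourhood Λ X r) (neighbourhood Λ Y r) :=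
    disjoint_neighbourhood fun x hx y hy => hd ▸ setDist_le hx hy
  let J : Finset {Z // Z ∈ Λ.powerset} := Finset.univ.filter fun Z =>
    (∀ y ∈ Z.1, ∀ z ∈ Z.1, dist y z ≤ r ^ (1 - δ)) ∧
      (Z.1 ⊆ neighbourhood Λ X r ∨ Z.1 ⊆ neighbourhood Λ Y r)
  set T := flow (∑ Z, localMap L Λ Z) t with hT
  set T' := flow (∑ Z ∈ J, localMap L Λ Z) t with hT'
  have hD := localGenerators_localMap (q := q) hL Λ
  -- A unital functional forces a configuration to exist, and any one serves as product state.
  obtain ⟨σ⟩ := hπ.isState.nonempty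
  set ω := entryFunctional σ with hω
  have hωs : IsState ω := isState_entryFunctional σ
  set a := embed hX A with ha
  set b := embed hY B with hb
  have hA : ‖a‖ ≤ ‖A‖ := norm_embed_le hX A
  have hB : ‖b‖ ≤ ‖B‖ := norm_embed_le hY B
  have hab : ‖a * b‖ ≤ ‖A‖ * ‖B‖ :=
    (norm_mul_le _ _).trans (mul_le_mul hA hB (norm_nonneg _) (norm_nonneg _))
  have hla : IsLocalizedIn X a := isLocalizedIn_embed hX A
  have hlb : IsLocalizedIn Y b := isLocalizedIn_embed hY B
  have hlaU := hla.mono (Finset.subset_union_left (s₂ := Y))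
  have hlbU := hlb.mono (Finset.subset_union_right (s₁ := X))
  set K := correlationConst κ ν α ε δ η L * ((X.card : ℝ) + Y.card) *
    (interactionNorm (powerLaw α) L).toReal *
    (1 / (1 + 2 * r) ^ ((1 - δ) * reducedExponent α ν ε - ν - η)) with hK
  have happrox : ∀ M : Obs q Λ, IsLocalizedIn (X ∪ Y) M → 3 * ‖T M - T' M‖ ≤ K * ‖M‖ := by
    intro M hM
    refine (norm_flow_sub_decoupled_flow_le hΓ hε.1 hα0 hL hL0 hδ.1.le hδ.2.le hη.le
      (hη'.trans_le (min_le_left _ _)).le (hη'.trans_le (min_le_right _ _)).le hX hY hr1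
      (J := J) (fun Z => by simp [J]) hM).trans (le_of_eq ?_)
    rw [hK]; ring
  have hconv : ∀ M : Obs q Λ, ‖π M - ω (T M)‖ ≤ g t * ‖M‖ := by
    intro M
    have h := hπ.convergence ω hωs M t ht0
    rwa [hπ.invariant t ht0, dynamics_apply] at h
  have hmul : ω (T' (a * b)) = ω (T' a) * ω (T' b) := by
    have hJ : ∀ Z ∈ J, Z.1 ⊆ neighbourhood Λ X r ∨ Z.1 ⊆ neighbourhood Λ Y r :=
      fun Z hZ => (Finset.mem_filter.1 hZ).2.2
    have hla' := hla.mono (subset_neighbourhood hX (by linarith : 0 < r))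
    have hlb' := hlb.mono (subset_neighbourhood hY (by linarith : 0 < r))
    rw [hT', flow_mul hdisj hJ hla' hlb']
    exact (hla'.flow_apply (fun Z hZ => (hJ Z hZ).imp_right fun h => hdisj.symm.mono_left h)
      t).mul_apply_self hdisj (hlb'.flow_apply (fun Z hZ => (hJ Z hZ).symm.imp_right
        fun h => hdisj.mono_left h) t) σ
  have hg0 : 0 ≤ g t := (hπ.range t ht0).1
  have hωd : ∀ M, ‖ω (T M) - ω (T' M)‖ ≤ ‖T M - T' M‖ := fun M => by
    rw [← map_sub]; exact hωs.norm_apply_le _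
  have hK0 : 0 ≤ K := by
    have := correlationConst_nonneg (q := q) hΓ hε.1 hα0 hδ.2.le η L
    have hr0 : 0 ≤ 1 + 2 * r := by linarith
    exact mul_nonneg (mul_nonneg (mul_nonneg this (add_nonneg (Nat.cast_nonneg _)
      (Nat.cast_nonneg _))) ENNReal.toReal_nonneg)
      (div_nonneg zero_le_one (Real.rpow_nonneg hr0 _))
  have hT'a : ‖ω (T' a)‖ ≤ ‖A‖ :=
    (hωs.norm_apply_le _).trans ((hD.norm_flow_apply_le J ht0 a).trans hA)
  have hTa : ‖ω (T a)‖ ≤ ‖A‖ :=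
    (hωs.norm_apply_le _).trans ((hD.norm_flow_apply_le Finset.univ ht0 a).trans hA)
  have hTb : ‖ω (T b)‖ ≤ ‖B‖ :=
    (hωs.norm_apply_le _).trans ((hD.norm_flow_apply_le Finset.univ ht0 b).trans hB)
  have hπb : ‖π b‖ ≤ ‖B‖ := (hπ.isState.norm_apply_le b).trans hB
  have e1 : ‖π (a * b) - ω (T (a * b))‖ ≤ g t * (‖A‖ * ‖B‖) :=
    (hconv _).trans (mul_le_mul_of_nonneg_left hab hg0)
  have e2 : ‖ω (T (a * b)) - ω (T' (a * b))‖ ≤ K * (‖A‖ * ‖B‖) / 3 := by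
    have h1 := happrox _ (hlaU.mul hlbU)
    have h2 := mul_le_mul_of_nonneg_left hab hK0
    linarith [hωd (a * b)]
  have e3 : ‖ω (T a) - ω (T' a)‖ ≤ K * ‖A‖ / 3 := by
    have h1 := happrox _ hlaU
    have h2 := mul_le_mul_of_nonneg_left hA hK0
    linarith [hωd a]
  have e4 : ‖ω (T b) - ω (T' b)‖ ≤ K * ‖B‖ / 3 := by
    have h1 := happrox _ hlbU
    have h2 := mul_le_mul_of_nonneg_left hB hK0
    linarith [hωd b]
  have e5 : ‖π a - ω (T a)‖ ≤ g t * ‖A‖ := (hconv _).trans (mul_le_mul_of_nonneg_left hA hg0)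
  have e6 : ‖π b - ω (T b)‖ ≤ g t * ‖B‖ := (hconv _).trans (mul_le_mul_of_nonneg_left hB hg0)
  -- Telescoping through `ω ∘ T` and `ω ∘ T'`. The three `T - T'` terms contribute `K / 3` each, the
  -- three convergence terms `g t` each, all times `‖A‖ * ‖B‖`.
  have hsplit : π (a * b) - π a * π b =
      (π (a * b) - ω (T (a * b))) + (ω (T (a * b)) - ω (T' (a * b)))
        - (ω (T b) - ω (T' b)) * ω (T' a) - (ω (T a) - ω (T' a)) * ω (T b)
        - (π b - ω (T b)) * ω (T a) - (π a - ω (T a)) * π b := by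
    rw [hmul]; ring
  have hbound : ∀ {u v : ℂ} {c d : ℝ}, ‖u‖ ≤ c → ‖v‖ ≤ d → ‖u * v‖ ≤ c * d := fun hu hv =>
    (norm_mul_le _ _).trans (mul_le_mul hu hv (norm_nonneg _) ((norm_nonneg _).trans hu))
  have f3 := hbound e4 hT'a
  have f4 := hbound e3 hTb
  have f5 := hbound e6 hTa
  have f6 := hbound e5 hπb
  rw [hsplit, htime, hd]
  refine (norm_sub_le_of_le (norm_sub_le_of_le (norm_sub_le_of_le (norm_sub_le_of_le
    (norm_add_le_of_le e1 e2) f3) f4) f5) f6).trans (le_of_eq ?_)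
  rw [hK]
  ring
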